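/- Let $\zeta$ be the Riemann zeta function. Throughout, $\mathrm{p.v.}\!\int_{-\infty}^{\infty}f(v)\,dv$ at a point $c$ means that $f$ is integrable on $\{|v-c|>\varepsilon\}$ for every $\varepsilon>0$ and denotes the limit $\lim_{\varepsilon\to0^+}\int_{|v-c|>\varepsilon}f(v)\,dv$. (1) For every real $t\ge 0$, $$\zeta\left(\tfrac12+it\right)=\frac12\ \mathrm{p.v.}\!\int_{-\infty}^{\infty}\frac{\zeta(i(t+v))+\zeta(1+i(t-v))}{\cosh(\pi v)}\,dv-\frac{\pi}{2\cosh(\pi t)},$$ where the principal value is taken at $v=t$ and exists. Moreover, the real part of the integrand is Lebesgue integrable on $\mathbb R$, and its integral is the real part of the principal value. (2) For real $a,b$ with $b\ne0$ let $H(a,b)=1$ if $1$ lies strictly between $a$ and $a+b$, $H(a,b)=\tfrac12$ if $a=1$ or $a+b=1$, and $H(a,b)=0$ otherwise. Thus $H\left(\tfrac{1-b}2,b\right)$ is $1$, $\tfrac12$ or $0$ according as $|b|>1$, $|b|=1$ or $|b|<1$. Then for all real $t$ and all real $b\neq0$, $$\zeta\left(\tfrac12+it\right)=\frac1{2|b|}\int_{-\infty}^{\infty}\frac{\zeta\left(\frac{1-b}2+i(t+v)\right)+\zeta\left(\frac{1+b}2+i(t-v)\right)}{\cosh(\pi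 v/b)}\,dv-\frac{i\pi\,H\left(\frac{1-b}2,b\right)}{b\left(\cos\left(\frac{\pi}{2b}\right)\sinh\left(\frac{\pi t}{b}\right)+i\cosh\left(\frac{\pi t}{b}\right)\sin\left(\frac{\pi}{2b}\right)\right)},$$ where the last term is read as $0$ when $H=0$, and its denominator is nonzero when $H\ne0$. The integral converges absolutely if $|b|\ne1$; if $|b|=1$ it is a principal value at $v=bt$, which exists. In all cases the real part of the integrand is Lebesgue integrable on $\mathbb R$, and its integral is the real part of the integral. -/

import Mathlib

open Complex MeasureTheory Filter Topology

/-- `I` is the Cauchy principal value, at the point `c`, of the integral of `f` over the real line: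
`f` is Lebesgue integrable off each symmetric neighbourhood of `c`, and the integrals over
`|v - c| > ε` tend to `I` as `ε → 0⁺`. -/
def HasPVIntegral (f : ℝ → ℂ) (c : ℝ) (I : ℂ) : Prop :=
  (∀ ε : ℝ, 0 < ε → IntegrableOn f {v : ℝ | ε < |v - c|}) ∧
    Tendsto (fun ε : ℝ => ∫ v in {v : ℝ | ε < |v - c|}, f v) (𝓝[>] 0) (𝓝 I)

/-- The integrand `[ζ(i(t+v)) + ζ(1+i(t-v))] / cosh(πv)`. -/
noncomputable def boundaryIntegrand (t v : ℝ) : ℂ :=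
  (riemannZeta (I * ((t : ℂ) + v)) + riemannZeta (1 + I * ((t : ℂ) - v))) /
    (Real.cosh (Real.pi * v) : ℂ)

/-- The integrand `[ζ((1-b)/2 + i(t+v)) + ζ((1+b)/2 + i(t-v))] / cosh(πv/b)`. -/
noncomputable def bIntegrand (t b v : ℝ) : ℂ :=
  (riemannZeta ((1 - (b : ℂ)) / 2 + I * ((t : ℂ) + v)) +
      riemannZeta ((1 + (b : ℂ)) / 2 + I * ((t : ℂ) - v))) /
    (Real.cosh (Real.pi * v / b) : ℂ)

/-- The weight `H(a,b)` of the residues at the pole `s = 1` of `ζ`: it is `1` when the line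
`Re s = 1` lies strictly between the lines `Re s = a` and `Re s = a + b` (for `b > 0` this is
`a < 1 < a + b`, for `b < 0` the inequalities are reversed), `1/2` when it coincides with one of
them, and `0` otherwise. -/
noncomputable def poleWeight (a b : ℝ) : ℝ :=
  if min a (a + b) < 1 ∧ 1 < max a (a + b) then 1
  else if a = 1 ∨ a + b = 1 then 1 / 2
  else 0

/-- `cos(π/(2b)) sinh(πt/b) + i cosh(πt/b) sin(π/(2b))`. -/
noncomputable def bDenominator (t b : ℝ) : ℂ :=
  (Real.cos (Real.pi / (2 * b)) : ℂ) * (Real.sinh (Real.pi * t / b) : ℂ) +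
    I * (Real.cosh (Real.pi * t / b) : ℂ) * (Real.sin (Real.pi / (2 * b)) : ℂ)

/-! Let `F` be holomorphic of polynomial growth on the closed strip `|Re w| ≤ b/2`. Then `(F w - F
0) / sin (π w / b)` is holomorphic there and tends to zero at both ends, so Cauchy's theorem equates
its integrals along the two edges. On the edges the sine is `±cosh (π y / b)`, and `sech (π y / b)`
has integral `b`; hence the edge values of `F` against `sech` integrate to `2 b F(0)`
(`integral_edgeIntegrand`).

The case of interest is `F w = ζ(1/2 + it + w)`, whose only pole is `p = 1/2 - it`. Write `ζ(s) =
1/(s-1) + ζ₀(s)`. The entire part `ζ₀` falls under the strip formula once it is known to grow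
polynomially (`exists_norm_riemannZeta₀_le`), which follows from repeated integration by parts.

For `(w - p)⁻¹` there are three cases. If `p` is outside the strip (`b < 1`), the formula applies as
it stands. If `p` is inside (`b > 1`), subtracting `(π/b) / sin (π (w - p) / b)` removes the pole;
that function changes sign under `w ↦ w + b`, so its edge integrals cancel, while its value at `0`
supplies the residue term. If `p` is on the edge (`b = 1`), the formulas for `p - δ` and `p + δ` are
averaged and `δ → 0⁺`: only one of them carries a residue, whence the weight `1/2`, and the averaged
kernel converges to the principal value (`hasPVIntegral_edgeIntegrand_pole`). Negative `b` reduces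
to positive `b` by `v ↦ -v`. -/

/-! ### Polynomial growth of zeta in right half-planes -/

lemma natCast_add_one_add_mem_slitPlane (n : ℕ) {x : ℝ} (hx : 0 ≤ x) :
    ((n : ℂ) + 1 + x) ∈ slitPlane := by
  left
  simp only [add_re, natCast_re, one_re, ofReal_re]
  positivity

lemma norm_natCast_add_one_add_cpow (n : ℕ) {x : ℝ} (hx : 0 ≤ x) (s : ℂ) :
    ‖((n : ℂ) + 1 + x) ^ s‖ = ((n : ℝ) + 1 + x) ^ s.re := by
  have h : ((n : ℂ) + 1 + x) = (((n : ℝ) + 1 + x : ℝ) : ℂ) := by push_cast; ring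
  rw [h, norm_cpow_eq_rpow_re_of_pos (by positivity)]

/-- The Dirichlet integral of `q` against `x ↦ (n + 1 + x) ^ (-s)` over the unit interval. -/
noncomputable def unitIntegral (q : ℝ → ℝ) (n : ℕ) (s : ℂ) : ℂ :=
  ∫ x in (0 : ℝ)..1, (q x : ℂ) * ((n : ℂ) + 1 + x) ^ (-s)

/-- The Dirichlet integral over `[1, ∞)` of the `1`-periodic extension of `q|[0,1)`. -/
noncomputable def periodicIntegral (q : ℝ → ℝ) (s : ℂ) : ℂ := ∑' n, unitIntegral q n s

lemma continuousOn_natCast_add_one_add_cpow (n : ℕ) (s : ℂ) :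
    ContinuousOn (fun x : ℝ => ((n : ℂ) + 1 + x) ^ s) (Set.uIcc 0 1) := by
  intro x hx
  rw [Set.uIcc_of_le zero_le_one] at hx
  refine ContinuousAt.continuousWithinAt ?_
  exact ContinuousAt.cpow (by fun_prop) continuousAt_const
    (natCast_add_one_add_mem_slitPlane n hx.1)

lemma intervalIntegrable_mul_cpow {q : ℝ → ℝ} (hq : Continuous q) (n : ℕ) (s : ℂ) :
    IntervalIntegrable (fun x : ℝ => (q x : ℂ) * ((n : ℂ) + 1 + x) ^ s) volume 0 1 :=
  ((by fun_prop : Continuous fun x : ℝ => (q x : ℂ)).continuousOn.mul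
    (continuousOn_natCast_add_one_add_cpow n s)).intervalIntegrable

lemma differentiable_unitIntegral {q : ℝ → ℝ} (hq : Continuous q) (n : ℕ) :
    Differentiable ℂ (unitIntegral q n) := by
  intro s
  have hc : ContinuousOn (fun p : ℂ × ℝ => (q p.2 : ℂ) *
      (((n : ℂ) + 1 + p.2) ^ (-p.1) * log ((n : ℂ) + 1 + p.2) * (-1)))
      (Metric.closedBall s 1 ×ˢ Set.Icc 0 1) := by
    rintro ⟨z, x⟩ ⟨-, hx⟩
    have hm := natCast_add_one_add_mem_slitPlane n hx.1
    refine ContinuousAt.continuousWithinAt ?_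
    refine ContinuousAt.mul (by fun_prop) (ContinuousAt.mul (ContinuousAt.mul ?_ ?_) (by fun_prop))
    · exact ContinuousAt.cpow (by fun_prop) (by fun_prop) hm
    · exact ContinuousAt.clog (by fun_prop) hm
  obtain ⟨C, hC⟩ := ((isCompact_closedBall s 1).prod isCompact_Icc).exists_bound_of_continuousOn hc
  have key := (intervalIntegral.hasDerivAt_integral_of_dominated_loc_of_deriv_le (μ := volume)
    (a := 0) (b := 1) (x₀ := s) (s := Metric.closedBall s 1)
    (F := fun z x => (q x : ℂ) * ((n : ℂ) + 1 + x) ^ (-z))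
    (F' := fun z x => (q x : ℂ) * (((n : ℂ) + 1 + x) ^ (-z) * log ((n : ℂ) + 1 + x) * (-1)))
    (bound := fun _ => C) (Metric.closedBall_mem_nhds s one_pos)
    (Eventually.of_forall fun z => (intervalIntegrable_mul_cpow hq n (-z)).def'.aestronglyMeasurable)
    (intervalIntegrable_mul_cpow hq n (-s)) ?_ ?_ (by simp) ?_).2
  · exact key.differentiableAt
  · have : ContinuousOn (fun x : ℝ => (q x : ℂ) *
        (((n : ℂ) + 1 + x) ^ (-s) * log ((n : ℂ) + 1 + x) * (-1))) (Set.uIcc 0 1) := by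
      rw [Set.uIcc_of_le zero_le_one]
      exact hc.comp (f := fun x : ℝ => (s, x)) (by fun_prop)
        fun x hx => ⟨Metric.mem_closedBall_self zero_le_one, hx⟩
    exact this.intervalIntegrable.def'.aestronglyMeasurable
  · refine Eventually.of_forall fun x hx z hz => ?_
    rw [Set.uIoc_of_le zero_le_one] at hx
    exact hC (z, x) ⟨hz, hx.1.le, hx.2⟩
  · refine Eventually.of_forall fun x hx z _ => ?_
    rw [Set.uIoc_of_le zero_le_one] at hx
    have hm := natCast_add_one_add_mem_slitPlane n hx.1.le
    exact ((hasDerivAt_neg z).const_cpow (Or.inl (slitPlane_ne_zero hm))).const_mul _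

lemma norm_unitIntegral_le {q : ℝ → ℝ} {M : ℝ} (hM : ∀ x ∈ Set.Icc (0 : ℝ) 1, ‖q x‖ ≤ M)
    (n : ℕ) {s : ℂ} {σ : ℝ} (hσ : 0 ≤ σ) (hs : σ ≤ s.re) :
    ‖unitIntegral q n s‖ ≤ M * ((n : ℝ) + 1) ^ (-σ) := by
  have := intervalIntegral.norm_integral_le_of_norm_le_const (a := 0) (b := 1)
    (f := fun x : ℝ => (q x : ℂ) * ((n : ℂ) + 1 + x) ^ (-s)) (C := M * ((n : ℝ) + 1) ^ (-σ)) ?_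
  · simpa [unitIntegral] using this
  · intro x hx
    rw [Set.uIoc_of_le zero_le_one] at hx
    rw [norm_mul, norm_natCast_add_one_add_cpow n hx.1.le, norm_real]
    have h1 : ((n : ℝ) + 1 + x) ^ (-s).re ≤ ((n : ℝ) + 1 + x) ^ (-σ) :=
      Real.rpow_le_rpow_of_exponent_le (by have := hx.1; linarith [Nat.cast_nonneg (α := ℝ) n])
        (by simpa using hs)
    have h2 : ((n : ℝ) + 1 + x) ^ (-σ) ≤ ((n : ℝ) + 1) ^ (-σ) :=
      Real.rpow_le_rpow_of_nonpos (by positivity) (by linarith [hx.1]) (by linarith)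
    exact mul_le_mul (hM x ⟨hx.1.le, hx.2⟩) (h1.trans h2) (by have := hx.1; positivity)
      ((norm_nonneg _).trans (hM x ⟨hx.1.le, hx.2⟩))

lemma summable_natCast_add_one_rpow_neg {σ : ℝ} (hσ : 1 < σ) :
    Summable fun n : ℕ => ((n : ℝ) + 1) ^ (-σ) := by
  have := (summable_nat_add_iff 1).mpr (Real.summable_nat_rpow.mpr (neg_lt_neg hσ))
  simpa using this

lemma summable_unitIntegral {q : ℝ → ℝ} (hq : Continuous q) {s : ℂ} (hs : 1 < s.re) :
    Summable fun n => unitIntegral q n s := by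
  obtain ⟨M, hM⟩ := isCompact_Icc.exists_bound_of_continuousOn (s := Set.Icc (0 : ℝ) 1)
    hq.continuousOn
  exact Summable.of_norm_bounded ((summable_natCast_add_one_rpow_neg hs).mul_left M)
    fun n => norm_unitIntegral_le hM n (by linarith) le_rfl

lemma norm_periodicIntegral_le {q : ℝ → ℝ} (hq : Continuous q) {σ : ℝ} (hσ : 1 < σ) :
    ∃ C, ∀ s : ℂ, σ ≤ s.re → ‖periodicIntegral q s‖ ≤ C := by
  obtain ⟨M, hM⟩ := isCompact_Icc.exists_bound_of_continuousOn (s := Set.Icc (0 : ℝ) 1)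
    hq.continuousOn
  exact ⟨_, fun s hs => tsum_of_norm_bounded
    ((summable_natCast_add_one_rpow_neg hσ).mul_left M).hasSum
    fun n => norm_unitIntegral_le hM n (by linarith) hs⟩

lemma differentiableOn_periodicIntegral {q : ℝ → ℝ} (hq : Continuous q) :
    DifferentiableOn ℂ (periodicIntegral q) {s | 1 < s.re} := by
  obtain ⟨M, hM⟩ := isCompact_Icc.exists_bound_of_continuousOn (s := Set.Icc (0 : ℝ) 1)
    hq.continuousOn
  intro s (hs : 1 < s.re)
  obtain ⟨σ, h1, h2⟩ := exists_between hs
  have ho : IsOpen {z : ℂ | σ < z.re} := isOpen_lt continuous_const continuous_re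
  have := differentiableOn_tsum_of_summable_norm
    ((summable_natCast_add_one_rpow_neg h1).mul_left M)
    (fun n => (differentiable_unitIntegral hq n).differentiableOn) ho
    fun n z hz => norm_unitIntegral_le hM n (by linarith) (le_of_lt hz)
  exact (this.differentiableAt (ho.mem_nhds h2)).differentiableWithinAt

lemma hasDerivAt_natCast_add_one_add_cpow (n : ℕ) {x : ℝ} (hx : 0 ≤ x) (s : ℂ) :
    HasDerivAt (fun x : ℝ => ((n : ℂ) + 1 + x) ^ s) (s * ((n : ℂ) + 1 + x) ^ (s - 1)) x := by
  have h : HasDerivAt (fun z : ℂ => (n : ℂ) + 1 + z) 1 (x : ℂ) := (hasDerivAt_id _).const_add _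
  simpa using (h.cpow_const (c := s) (natCast_add_one_add_mem_slitPlane n hx)).comp_ofReal

/-- Integration by parts on one unit interval. It is used with `Q = 1` (telescoping), with `Q`
vanishing at both endpoints (raising the abscissa), and with `Q = 1 - x` (recovering the Dirichlet
series). -/
lemma integral_deriv_mul_cpow {Q q : ℝ → ℝ} (hq : Continuous q) (hQ : ∀ x, HasDerivAt Q (q x) x)
    (n : ℕ) (s : ℂ) :
    ∫ x in (0 : ℝ)..1, (q x : ℂ) * ((n : ℂ) + 1 + x) ^ (-s) =
      (Q 1 : ℂ) * ((n : ℂ) + 2) ^ (-s) - (Q 0 : ℂ) * ((n : ℂ) + 1) ^ (-s) +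
        s * unitIntegral Q n (s + 1) := by
  have hQc : Continuous Q := continuous_iff_continuousAt.mpr fun x => (hQ x).continuousAt
  have hd : ∀ x ∈ Set.uIcc (0 : ℝ) 1, HasDerivAt (fun x : ℝ => (Q x : ℂ) * ((n : ℂ) + 1 + x) ^ (-s))
      ((q x : ℂ) * ((n : ℂ) + 1 + x) ^ (-s) +
        (-s) * ((Q x : ℂ) * ((n : ℂ) + 1 + x) ^ (-(s + 1)))) x := by
    intro x hx
    rw [Set.uIcc_of_le zero_le_one] at hx
    refine ((hQ x).ofReal_comp.mul
      (hasDerivAt_natCast_add_one_add_cpow n hx.1 (-s))).congr_deriv ?_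
    rw [show -(s + 1) = -s - 1 by ring]
    ring
  have h1 := intervalIntegrable_mul_cpow hq n (-s)
  have h2 := (intervalIntegrable_mul_cpow hQc n (-(s + 1))).const_mul (-s)
  have := intervalIntegral.integral_eq_sub_of_hasDerivAt hd (h1.add h2)
  rw [intervalIntegral.integral_add h1 h2, intervalIntegral.integral_const_mul] at this
  rw [unitIntegral]
  rw [ofReal_zero, ofReal_one, add_zero] at this
  linear_combination this + (Q 1 : ℂ) * (congrArg (· ^ (-s)) (by ring : (n : ℂ) + 1 + 1 = n + 2))

/-- Each term is `((n+1)^(-s) - (n+2)^(-s)) / s`, so the sum telescopes. This is the source of the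
pole at `1`. -/
lemma hasSum_sub_cpow {s : ℂ} (hs : 0 < s.re) :
    HasSum (fun n : ℕ => unitIntegral (fun _ => 1) n (s + 1)) (1 / s) := by
  have h0 : s ≠ 0 := by rintro rfl; simp at hs
  have hterm (n : ℕ) : unitIntegral (fun _ => 1) n (s + 1) =
      (((n : ℂ) + 1) ^ (-s) - ((n + 1 : ℕ) + 1 : ℂ) ^ (-s)) / s := by
    have := integral_deriv_mul_cpow (Q := fun _ => 1) (q := fun _ => 0) continuous_const
      (fun x => hasDerivAt_const x 1) n s
    simp only [ofReal_zero, zero_mul, intervalIntegral.integral_zero, ofReal_one, one_mul] at this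
    rw [eq_div_iff h0, Nat.cast_add, Nat.cast_one, add_assoc (n : ℂ) 1 1, one_add_one_eq_two]
    linear_combination -this
  refine (summable_unitIntegral continuous_const (by simpa using hs)).hasSum_iff_tendsto_nat.mpr ?_
  simp_rw [hterm, ← Finset.sum_div,
    Finset.sum_range_sub' (fun n : ℕ => ((n : ℂ) + 1) ^ (-s))]
  refine Tendsto.div_const ?_ s
  have : Tendsto (fun n : ℕ => ((n : ℂ) + 1) ^ (-s)) atTop (𝓝 0) := by
    rw [tendsto_zero_iff_norm_tendsto_zero]
    have h : Tendsto (fun n : ℕ => ((n : ℝ) + 1) ^ (-s.re)) atTop (𝓝 0) :=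
      (tendsto_rpow_neg_atTop hs).comp
        (tendsto_atTop_add_const_right _ _ tendsto_natCast_atTop_atTop)
    refine h.congr fun n => ?_
    simpa using (norm_natCast_add_one_add_cpow n le_rfl (-s)).symm
  simpa using this.const_sub ((((0 : ℕ) : ℂ) + 1) ^ (-s))

/-- Integration by parts, raising the abscissa by one. -/
lemma periodicIntegral_eq {q : ℝ → ℝ} (hq : Continuous q) {s : ℂ} (hs : 1 < s.re) :
    (s - 1) * periodicIntegral q s = (∫ x in (0 : ℝ)..1, q x : ℝ) +
      s * (s - 1) * periodicIntegral
        (fun y => ∫ x in (0 : ℝ)..y, (q x - ∫ x in (0 : ℝ)..1, q x)) (s + 1) := by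
  set m := ∫ x in (0 : ℝ)..1, q x with hm
  -- Removing the mean makes the primitive vanish at both endpoints, so the boundary terms
  -- disappear.
  set Q : ℝ → ℝ := fun y => ∫ x in (0 : ℝ)..y, (q x - m) with hQ
  have hc : Continuous fun x => q x - m := by fun_prop
  have hd (x : ℝ) : HasDerivAt Q (q x - m) x :=
    intervalIntegral.integral_hasDerivAt_right (hc.intervalIntegrable _ _)
      (hc.stronglyMeasurableAtFilter _ _) hc.continuousAt
  have hQc : Continuous Q := continuous_iff_continuousAt.mpr fun x => (hd x).continuousAt
  have hQ0 : Q 0 = 0 := by simp [hQ]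
  have hQ1 : Q 1 = 0 := by
    simp only [hQ]
    rw [intervalIntegral.integral_sub (hq.intervalIntegrable _ _) (by simp), ← hm]
    simp
  have hterm (n : ℕ) : unitIntegral q n s =
      m * unitIntegral (fun _ => 1) n s + s * unitIntegral Q n (s + 1) := by
    have := integral_deriv_mul_cpow hc hd n s
    rw [hQ0, hQ1] at this
    simp only [ofReal_zero, zero_mul, sub_zero, zero_add, ofReal_sub, sub_mul] at this
    rw [intervalIntegral.integral_sub (intervalIntegrable_mul_cpow hq n (-s))
      (intervalIntegrable_mul_cpow (q := fun _ => m) continuous_const n (-s)),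
      intervalIntegral.integral_const_mul] at this
    simp only [unitIntegral, ofReal_one, one_mul] at this ⊢
    linear_combination this
  have h1 := (hasSum_sub_cpow (s := s - 1) (by simpa using hs)).mul_left (m : ℂ)
  rw [sub_add_cancel] at h1
  have h2 := (summable_unitIntegral hQc (s := s + 1)
    (by simp only [add_re, one_re]; linarith)).hasSum.mul_left s
  have hs1 : s - 1 ≠ 0 := by
    intro h
    rw [sub_eq_zero.mp h] at hs
    simp at hs
  rw [periodicIntegral, tsum_congr hterm, (h1.add h2).tsum_eq, ← periodicIntegral]
  field_simp

/-- Analytic continuation of `(s - 1) * periodicIntegral q s`, with polynomial bounds. -/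
lemma exists_continuation_periodicIntegral (K : ℕ) {q : ℝ → ℝ} (hq : Continuous q) :
    ∃ E : ℂ → ℂ, DifferentiableOn ℂ E {s | 1 - (K : ℝ) < s.re} ∧
      (∀ s : ℂ, 1 < s.re → E s = (s - 1) * periodicIntegral q s) ∧
      ∀ σ : ℝ, 1 - (K : ℝ) < σ → ∃ (C : ℝ) (N : ℕ), ∀ s : ℂ, σ ≤ s.re → ‖E s‖ ≤ C * (1 + ‖s‖) ^ N := by
  induction K generalizing q with
  | zero =>
    refine ⟨fun s => (s - 1) * periodicIntegral q s, ?_, fun _ _ => rfl, fun σ hσ => ?_⟩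
    · rw [Nat.cast_zero, sub_zero]
      exact DifferentiableOn.mul (by fun_prop) (differentiableOn_periodicIntegral hq)
    · obtain ⟨C, hC⟩ := norm_periodicIntegral_le hq (σ := σ) (by simpa using hσ)
      refine ⟨C, 1, fun s hs => ?_⟩
      rw [norm_mul, mul_comm, pow_one]
      have h1 : ‖s - 1‖ ≤ 1 + ‖s‖ := (norm_sub_le s 1).trans (by simp [add_comm])
      exact mul_le_mul (hC s hs) h1 (norm_nonneg _) ((norm_nonneg _).trans (hC s hs))
  | succ K ih =>
    set m := ∫ x in (0 : ℝ)..1, q x with hm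
    have hc : Continuous fun x => q x - m := by fun_prop
    have hQc : Continuous fun y => ∫ x in (0 : ℝ)..y, (q x - m) :=
      intervalIntegral.continuous_primitive (fun a b => hc.intervalIntegrable a b) 0
    obtain ⟨E, hE, hEq, hb⟩ := ih hQc
    -- At `s + 1` the normalising factor of `E` is `s`, which absorbs the factor `s` produced by the
    -- integration by parts.
    refine ⟨fun s => m + (s - 1) * E (s + 1), ?_, fun s hs => ?_, fun σ hσ => ?_⟩
    · refine DifferentiableOn.const_add _ (DifferentiableOn.mul (by fun_prop) ?_)
      refine hE.comp (by fun_prop) fun s hs => ?_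
      simp only [Set.mem_ofPred_eq, Nat.cast_add, Nat.cast_one, add_re, one_re] at hs ⊢
      linarith
    · beta_reduce
      rw [periodicIntegral_eq hq hs, hEq (s + 1) (by simp only [add_re, one_re]; linarith)]
      ring
    · obtain ⟨C, N, hC⟩ := hb (σ + 1) (by push_cast at hσ; linarith)
      -- The `2 ^ N` comes from `1 + ‖s + 1‖ ≤ 2 (1 + ‖s‖)`.
      refine ⟨|m| + |C| * 2 ^ N, N + 1, fun s hs => ?_⟩
      have h0 : 0 ≤ ‖s‖ := norm_nonneg s
      have h1 : ‖s - 1‖ ≤ 1 + ‖s‖ := (norm_sub_le s 1).trans (by simp [add_comm])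
      have h2 : ‖s + 1‖ ≤ ‖s‖ + 1 := (norm_add_le s 1).trans (by simp)
      have h3 : ‖E (s + 1)‖ ≤ |C| * (2 ^ N * (1 + ‖s‖) ^ N) := by
        refine (hC (s + 1) (by simpa using hs)).trans ?_
        rw [← mul_pow]
        gcongr
        · exact le_abs_self C
        · linarith
      calc ‖(m : ℂ) + (s - 1) * E (s + 1)‖ ≤ |m| * 1 + (1 + ‖s‖) * (|C| * (2 ^ N * (1 + ‖s‖) ^ N)) := by
            refine (norm_add_le _ _).trans ?_
            rw [norm_mul, norm_real, Real.norm_eq_abs, mul_one]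
            gcongr
        _ ≤ |m| * (1 + ‖s‖) ^ (N + 1) + (1 + ‖s‖) * (|C| * (2 ^ N * (1 + ‖s‖) ^ N)) := by
            gcongr
            exact one_le_pow₀ (by linarith)
        _ = _ := by ring

lemma riemannZeta_eq_periodicIntegral {s : ℂ} (hs : 1 < s.re) :
    riemannZeta s = 1 / (s - 1) + s * periodicIntegral (fun x => 1 - x) (s + 1) := by
  have hterm (n : ℕ) : 1 / ((n : ℂ) + 1) ^ s =
      unitIntegral (fun _ => 1) n s + s * unitIntegral (fun x => 1 - x) n (s + 1) := by
    have := integral_deriv_mul_cpow (Q := fun x => 1 - x) (q := fun _ => -1) continuous_const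
      (fun x => by simpa using (hasDerivAt_id x).const_sub 1) n s
    simp only [ofReal_neg, ofReal_one, neg_mul, one_mul, intervalIntegral.integral_neg, sub_self,
      ofReal_zero, zero_mul, sub_zero, zero_sub] at this
    simp only [unitIntegral, ofReal_one, one_mul, one_div, ← cpow_neg] at this ⊢
    linear_combination this
  have h1 := hasSum_sub_cpow (s := s - 1) (by simpa using hs)
  rw [sub_add_cancel] at h1
  have h2 := (summable_unitIntegral (q := fun x => 1 - x) (by fun_prop) (s := s + 1)
    (by simp only [add_re, one_re]; linarith)).hasSum.mul_left s
  rw [zeta_eq_tsum_one_div_nat_add_one_cpow hs, tsum_congr hterm, (h1.add h2).tsum_eq,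
    ← periodicIntegral]

/-- `ζ(s) - 1/(s-1)` grows at most polynomially in every right half-plane. -/
theorem exists_norm_riemannZeta₀_le (σ : ℝ) :
    ∃ (C : ℝ) (N : ℕ), ∀ s : ℂ, σ ≤ s.re → ‖riemannZeta₀ s‖ ≤ C * (1 + ‖s‖) ^ N := by
  obtain ⟨K, hK⟩ := exists_nat_gt (-σ)
  obtain ⟨E, hE, hEq, hb⟩ := exists_continuation_periodicIntegral K
    (q := fun x => 1 - x) (by fun_prop)
  obtain ⟨C, N, hC⟩ := hb (σ + 1) (by linarith)
  have ho : IsOpen {s : ℂ | -(K : ℝ) < s.re} := isOpen_lt continuous_const continuous_re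
  have hE' : DifferentiableOn ℂ (fun s => E (s + 1)) {s : ℂ | -(K : ℝ) < s.re} := by
    refine hE.comp (by fun_prop) fun s hs => ?_
    simp only [Set.mem_ofPred_eq, add_re, one_re] at hs ⊢
    linarith
  -- Both sides agree near `2`, where the series converge; the identity theorem carries the equality
  -- over the half-plane.
  have heq : Set.EqOn riemannZeta₀ (fun s => E (s + 1)) {s : ℂ | -(K : ℝ) < s.re} := by
    refine AnalyticOnNhd.eqOn_of_preconnected_of_eventuallyEq (z₀ := 2)
      (differentiable_riemannZeta₀.differentiableOn.analyticOnNhd ho) (hE'.analyticOnNhd ho)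
      (convex_halfSpace_re_gt _).isPreconnected ?_ ?_
    · simp only [Set.mem_ofPred_eq, re_ofNat]
      linarith [Nat.cast_nonneg (α := ℝ) K]
    · filter_upwards [(isOpen_lt continuous_const continuous_re).mem_nhds
        (show (2 : ℂ) ∈ {s : ℂ | 1 < s.re} by simp)] with s hs
      have hs' : 1 < s.re := hs
      have hs1 : s ≠ 1 := by rintro rfl; simp at hs'
      have h := riemannZeta_eq_periodicIntegral hs'
      rw [riemannZeta_eq_inv_sub_add hs1] at h
      rw [hEq _ (by simp only [add_re, one_re]; linarith)]
      linear_combination h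
  refine ⟨|C| * 2 ^ N, N, fun s hs => ?_⟩
  rw [heq (show -(K : ℝ) < s.re by linarith)]
  have h0 : 0 ≤ ‖s‖ := norm_nonneg s
  have h2 : ‖s + 1‖ ≤ ‖s‖ + 1 := (norm_add_le s 1).trans (by simp)
  refine (hC (s + 1) (by simpa using hs)).trans ?_
  rw [mul_assoc, ← mul_pow]
  gcongr
  · exact le_abs_self C
  · linarith

/-! ### The hyperbolic secant: integrability and total mass -/

lemma exists_one_add_abs_pow_le_cosh {c : ℝ} (hc : 0 < c) (M : ℕ) :
    ∃ K : ℝ, 0 < K ∧ ∀ v : ℝ, (1 + |v|) ^ M ≤ K * Real.cosh (c * v) := by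
  -- From `x ^ M / M! ≤ exp x` at `x = c (1 + |v|)` and `exp (c |v|) ≤ 2 cosh (c v)`.
  refine ⟨M.factorial / c ^ M * Real.exp c * 2, by positivity, fun v => ?_⟩
  have h := Real.pow_div_factorial_le_exp (c * (1 + |v|)) (by positivity) M
  have h2 : Real.exp (c * |v|) ≤ 2 * Real.cosh (c * v) := by
    rw [← Real.cosh_abs, abs_mul, abs_of_pos hc, Real.cosh_eq]
    linarith [Real.exp_pos (-(c * |v|))]
  rw [div_le_iff₀ (by positivity), mul_pow, mul_add, mul_one, Real.exp_add] at h
  have h3 : (1 + |v|) ^ M ≤ Real.exp c * Real.exp (c * |v|) * M.factorial / c ^ M := by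
    rw [le_div_iff₀ (by positivity)]
    linarith
  calc (1 + |v|) ^ M ≤ Real.exp c * Real.exp (c * |v|) * M.factorial / c ^ M := h3
    _ ≤ Real.exp c * (2 * Real.cosh (c * v)) * M.factorial / c ^ M := by gcongr
    _ = _ := by ring

/-- A continuous function of polynomial growth is integrable against `sech`. -/
lemma integrable_div_cosh {b : ℝ} (hb : 0 < b) {g : ℝ → ℂ} (hg : Continuous g) {C R : ℝ} {N : ℕ}
    (h : ∀ v, R ≤ |v| → ‖g v‖ ≤ C * (1 + |v|) ^ N) :
    Integrable fun v : ℝ => g v / (Real.cosh (Real.pi * v / b) : ℂ) := by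
  have hpos (v : ℝ) : 0 < Real.cosh (Real.pi * v / b) := Real.cosh_pos _
  have hcont : Continuous fun v : ℝ => g v / (Real.cosh (Real.pi * v / b) : ℂ) := by
    refine hg.div ?_ fun v => ofReal_ne_zero.mpr (hpos v).ne'
    exact continuous_ofReal.comp (Real.continuous_cosh.comp (by fun_prop))
  -- The two extra powers leave a majorant of order `1 / (1 + v²)`.
  obtain ⟨K, hK0, hK⟩ := exists_one_add_abs_pow_le_cosh (c := Real.pi / b) (by positivity) (N + 2)
  refine hcont.locallyIntegrable.integrable_of_isBigO_cocompact (g := fun v : ℝ => (1 + v ^ 2)⁻¹)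
    ?_ (integrable_inv_one_add_sq.integrableAtFilter _)
  refine Asymptotics.IsBigO.of_bound (|C| * K) ?_
  have : ∀ᶠ v : ℝ in cocompact ℝ, R ≤ |v| := tendsto_norm_cocompact_atTop.eventually_ge_atTop R
  filter_upwards [this] with v hv
  have h1 := h v hv
  have h2 := hK v
  rw [show Real.pi / b * v = Real.pi * v / b by ring] at h2
  rw [norm_div, norm_real, Real.norm_of_nonneg (hpos v).le,
    Real.norm_of_nonneg (by positivity : (0 : ℝ) ≤ (1 + v ^ 2)⁻¹), div_le_iff₀ (hpos v),
    mul_assoc, mul_comm _⁻¹, mul_assoc, ← mul_assoc K, ← div_eq_mul_inv]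
  have h3 : (1 + |v|) ^ N * (1 + v ^ 2) ≤ (1 + |v|) ^ (N + 2) := by
    rw [pow_add]
    gcongr
    nlinarith [sq_abs v, abs_nonneg v]
  calc ‖g v‖ ≤ C * (1 + |v|) ^ N := h1
    _ ≤ |C| * (1 + |v|) ^ N := by gcongr; exact le_abs_self C
    _ ≤ |C| * (K * Real.cosh (Real.pi * v / b) / (1 + v ^ 2)) := by
      gcongr
      rw [le_div_iff₀ (by positivity)]
      exact h3.trans h2

lemma integral_inv_cosh {b : ℝ} (hb : 0 < b) :
    ∫ v : ℝ, (Real.cosh (Real.pi * v / b))⁻¹ = b := by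
  have hint : Integrable fun v : ℝ => (Real.cosh (Real.pi * v / b))⁻¹ := by
    have := (integrable_div_cosh hb (g := fun _ => 1) continuous_const (C := 1) (R := 0) (N := 0)
      (by simp)).re
    refine this.congr (Eventually.of_forall fun v => ?_)
    simp only [one_div, ← ofReal_inv]
    exact ofReal_re _
  have hd (v : ℝ) : HasDerivAt
      (fun v => b / Real.pi * Real.arctan (Real.sinh (Real.pi * v / b)))
      (Real.cosh (Real.pi * v / b))⁻¹ v := by
    have h1 : HasDerivAt (fun v : ℝ => Real.pi * v / b) (Real.pi / b) v := by
      simpa using ((hasDerivAt_id v).const_mul Real.pi).div_const b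
    refine (((Real.hasDerivAt_sinh _).comp v h1).arctan.const_mul (b / Real.pi)).congr_deriv ?_
    have hc := (Real.cosh_pos (Real.pi * v / b)).ne'
    have hpi := Real.pi_ne_zero
    rw [Function.comp_apply, ← Real.cosh_sq']
    field_simp
  have hlin : Tendsto (fun v : ℝ => Real.pi * v / b) atTop atTop :=
    (tendsto_id.const_mul_atTop Real.pi_pos).atTop_div_const hb
  have hlin' : Tendsto (fun v : ℝ => Real.pi * v / b) atBot atBot :=
    (tendsto_id.const_mul_atBot Real.pi_pos).atBot_div_const hb
  have ht : Tendsto (fun v => b / Real.pi * Real.arctan (Real.sinh (Real.pi * v / b))) atTop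
      (𝓝 (b / Real.pi * (Real.pi / 2))) :=
    (((Real.tendsto_arctan_atTop.mono_right nhdsWithin_le_nhds).comp
      (Real.sinhOrderIso.tendsto_atTop.comp hlin)).const_mul _)
  have hb' : Tendsto (fun v => b / Real.pi * Real.arctan (Real.sinh (Real.pi * v / b))) atBot
      (𝓝 (b / Real.pi * (-(Real.pi / 2)))) :=
    (((Real.tendsto_arctan_atBot.mono_right nhdsWithin_le_nhds).comp
      (Real.sinhOrderIso.tendsto_atBot.comp hlin')).const_mul _)
  rw [integral_of_hasDerivAt_of_tendsto hd hint hb' ht]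
  have hpi := Real.pi_ne_zero
  field_simp
  ring

/-! ### The sine kernel -/

lemma differentiableAt_dslope {f : ℂ → ℂ} {c w : ℂ} (hc : ∀ᶠ z in 𝓝 c, DifferentiableAt ℂ f z)
    (hw : DifferentiableAt ℂ f w) : DifferentiableAt ℂ (dslope f c) w := by
  rcases eq_or_ne w c with rfl | hne
  · exact ((Complex.differentiableOn_dslope hc).mpr
      fun z hz => DifferentiableAt.differentiableWithinAt hz).differentiableAt hc
  · exact (differentiableAt_dslope_of_ne hne).mpr hw

/-- The entire function `w ↦ sin (π w / b) / w`. -/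
noncomputable def sinQuotient (b : ℝ) : ℂ → ℂ := dslope (fun w => sin (Real.pi * w / b)) 0

lemma differentiable_sinQuotient (b : ℝ) : Differentiable ℂ (sinQuotient b) := fun _ =>
  differentiableAt_dslope (Eventually.of_forall fun _ => by fun_prop) (by fun_prop)

lemma sinQuotient_zero (b : ℝ) : sinQuotient b 0 = Real.pi / b := by
  have h1 : HasDerivAt (fun w : ℂ => (Real.pi : ℂ) * w / b) (Real.pi / b) 0 := by
    simpa using ((hasDerivAt_id (0 : ℂ)).const_mul (Real.pi : ℂ)).div_const (b : ℂ)
  rw [sinQuotient, dslope_same, h1.csin.deriv]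
  simp

lemma mul_sinQuotient (b : ℝ) (w : ℂ) : w * sinQuotient b w = sin (Real.pi * w / b) := by
  simpa [sinQuotient] using sub_smul_dslope (fun w : ℂ => sin (Real.pi * w / b)) 0 w

lemma sin_pi_mul_div_ne_zero {b : ℝ} (hb : 0 < b) {w : ℂ} (hw : |w.re| < b) (h0 : w ≠ 0) :
    sin (Real.pi * w / b) ≠ 0 := by
  rw [Complex.sin_ne_zero_iff]
  intro k hk
  have hpi : (Real.pi : ℂ) ≠ 0 := ofReal_ne_zero.mpr Real.pi_ne_zero
  have hb' : (b : ℂ) ≠ 0 := ofReal_ne_zero.mpr hb.ne'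
  have hwk : w = ((k * b : ℝ) : ℂ) := by
    field_simp at hk
    push_cast
    linear_combination hk
  have hk0 : |(k : ℝ)| < 1 := by
    rw [hwk, ofReal_re, abs_mul, abs_of_pos hb] at hw
    nlinarith
  have : k = 0 := Int.abs_lt_one_iff.mp (by exact_mod_cast hk0)
  exact h0 (by simp [hwk, this])

/-- The region has twice the width of the strip `|Re w| ≤ b/2`, so the result also covers
differences `w - p` with `w` in the closed strip and `p` in its interior. -/
lemma sinQuotient_ne_zero {b : ℝ} (hb : 0 < b) {w : ℂ} (hw : |w.re| < b) :
    sinQuotient b w ≠ 0 := by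
  rcases eq_or_ne w 0 with rfl | h0
  · rw [sinQuotient_zero]
    exact div_ne_zero (ofReal_ne_zero.mpr Real.pi_ne_zero) (ofReal_ne_zero.mpr hb.ne')
  · exact right_ne_zero_of_mul (mul_sinQuotient b w ▸ sin_pi_mul_div_ne_zero hb hw h0)

/-- With `y = Im z`, the triangle inequality for the two exponentials gives `‖sin z‖ ≥ |sinh y|`,
and `cosh y - |sinh y| = exp (-|y|) ≤ 1`. -/
lemma cosh_sub_one_le_norm_sin (z : ℂ) : Real.cosh z.im - 1 ≤ ‖sin z‖ := by
  have h1 : ‖exp (-z * I)‖ = Real.exp z.im := by simp [Complex.norm_exp]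
  have h2 : ‖exp (z * I)‖ = Real.exp (-z.im) := by simp [Complex.norm_exp]
  have h3 : ‖sin z‖ = ‖exp (-z * I) - exp (z * I)‖ / 2 := by simp [Complex.sin]
  have h4 := abs_norm_sub_norm_le (exp (-z * I)) (exp (z * I))
  rw [h1, h2] at h4
  have h5 : Real.exp |z.im| - 1 ≤ |Real.exp z.im - Real.exp (-z.im)| := by
    rcases le_total 0 z.im with h | h
    · rw [abs_of_nonneg h]
      have : Real.exp (-z.im) ≤ 1 := Real.exp_le_one_iff.mpr (by linarith)
      linarith [le_abs_self (Real.exp z.im - Real.exp (-z.im))]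
    · rw [abs_of_nonpos h]
      have : Real.exp z.im ≤ 1 := Real.exp_le_one_iff.mpr h
      linarith [neg_abs_le (Real.exp z.im - Real.exp (-z.im))]
  have h6 : Real.cosh z.im ≤ (Real.exp |z.im| + 1) / 2 := by
    rw [← Real.cosh_abs, Real.cosh_eq]
    have : Real.exp (-|z.im|) ≤ 1 := Real.exp_le_one_iff.mpr (by linarith [abs_nonneg z.im])
    linarith
  rw [h3]
  linarith

/-! ### The strip formula -/

/-- Polynomial growth of `F` at both ends of the closed strip `|Re w| ≤ β`. -/
def StripGrowth (β : ℝ) (F : ℂ → ℂ) : Prop :=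
  ∃ (C : ℝ) (N : ℕ) (R : ℝ), ∀ w : ℂ, |w.re| ≤ β → R ≤ |w.im| → ‖F w‖ ≤ C * (1 + |w.im|) ^ N

/-- The sum of the two edge values of `f` on the strip `|Re w| ≤ b / 2`, against `sech`. -/
noncomputable def edgeIntegrand (b : ℝ) (f : ℂ → ℂ) (v : ℝ) : ℂ :=
  (f (-(b : ℂ) / 2 + I * v) + f ((b : ℂ) / 2 - I * v)) / (Real.cosh (Real.pi * v / b) : ℂ)

lemma integrable_edge {b : ℝ} (hb : 0 < b) {F : ℂ → ℂ} (hF : ∀ w : ℂ, |w.re| ≤ b / 2 →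
    ContinuousAt F w) (hg : StripGrowth (b / 2) F) {a : ℝ} (ha : |a| ≤ b / 2) :
    Integrable fun v : ℝ => F (a + I * v) / (Real.cosh (Real.pi * v / b) : ℂ) := by
  obtain ⟨C, N, R, h⟩ := hg
  refine integrable_div_cosh hb (continuous_iff_continuousAt.mpr fun v => ?_) (C := C) (R := R)
    (N := N) fun v hv => ?_
  · refine ContinuousAt.comp (f := fun v : ℝ => (a : ℂ) + I * v) (hF _ ?_) (by fun_prop)
    simpa using ha
  · simpa using h (a + I * v) (by simpa using ha) (by simpa using hv)

/-- The right edge enters the integrand traversed downwards; as `cosh` is even, `v ↦ -v` turns it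
upwards, as Cauchy's theorem requires. -/
lemma integrable_and_integral_edgeIntegrand {b : ℝ} {F : ℂ → ℂ}
    (h1 : Integrable fun v : ℝ => F (((-(b / 2) : ℝ) : ℂ) + I * v) /
      (Real.cosh (Real.pi * v / b) : ℂ))
    (h2 : Integrable fun v : ℝ => F (((b / 2 : ℝ) : ℂ) + I * v) /
      (Real.cosh (Real.pi * v / b) : ℂ)) :
    Integrable (edgeIntegrand b F) ∧ ∫ v, edgeIntegrand b F v =
      (∫ v : ℝ, F (((-(b / 2) : ℝ) : ℂ) + I * v) / (Real.cosh (Real.pi * v / b) : ℂ)) +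
      ∫ v : ℝ, F (((b / 2 : ℝ) : ℂ) + I * v) / (Real.cosh (Real.pi * v / b) : ℂ) := by
  have he : edgeIntegrand b F = fun v : ℝ =>
      F (((-(b / 2) : ℝ) : ℂ) + I * v) / (Real.cosh (Real.pi * v / b) : ℂ) +
      F (((b / 2 : ℝ) : ℂ) + I * (-v : ℝ)) / (Real.cosh (Real.pi * (-v) / b) : ℂ) := by
    ext v
    rw [edgeIntegrand, mul_neg, neg_div b (Real.pi * v), Real.cosh_neg, ← add_div]
    push_cast
    ring_nf
  have h2' := h2.comp_neg
  rw [he]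
  refine ⟨h1.add h2', ?_⟩
  rw [integral_add h1 h2', integral_neg_eq_self (fun v : ℝ => F (((b / 2 : ℝ) : ℂ) + I * v) /
      (Real.cosh (Real.pi * v / b) : ℂ))]

/-- The quotient `(F w - F 0) / sin (π w / b)` tends to zero uniformly at the ends of the strip. -/
lemma eventually_norm_dslope_div_le {b : ℝ} (hb : 0 < b) {F : ℂ → ℂ} (hg : StripGrowth (b / 2) F)
    {ε : ℝ} (hε : 0 < ε) :
    ∀ᶠ T in atTop, ∀ w : ℂ, |w.re| ≤ b / 2 → |w.im| = T →
      ‖dslope F 0 w / sinQuotient b w‖ ≤ ε := by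
  obtain ⟨C, N, R, h⟩ := hg
  obtain ⟨K, hK0, hK⟩ := exists_one_add_abs_pow_le_cosh (c := Real.pi / b) (by positivity) (N + 1)
  -- `T ≥ 2K` absorbs the `-1` in `cosh - 1`; the last condition makes the quotient, of order `1 /
  -- (1 + T)`, at most `ε`.
  filter_upwards [eventually_ge_atTop R, eventually_gt_atTop 0, eventually_ge_atTop (2 * K),
    eventually_ge_atTop ((|C| + ‖F 0‖) * (2 * K) / ε)] with T hR h0 h2K hT w hw him
  have hw0 : w ≠ 0 := by
    rintro rfl
    simp at him
    linarith
  have hF : ‖F w - F 0‖ ≤ (|C| + ‖F 0‖) * (1 + T) ^ N := by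
    refine (norm_sub_le _ _).trans ?_
    have h1 := h w hw (him ▸ hR)
    rw [him] at h1
    have h2 : C * (1 + T) ^ N ≤ |C| * (1 + T) ^ N := by gcongr; exact le_abs_self C
    have h3 : ‖F 0‖ * 1 ≤ ‖F 0‖ * (1 + T) ^ N := by gcongr; exact one_le_pow₀ (by linarith)
    linarith
  have hs : (1 + T) ^ (N + 1) / (2 * K) ≤ ‖sin (Real.pi * w / b)‖ := by
    have h1 := cosh_sub_one_le_norm_sin (Real.pi * w / b)
    have h2 := hK w.im
    have h3 : (Real.pi * w / b : ℂ).im = Real.pi / b * w.im := by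
      rw [show (Real.pi * w / b : ℂ) = ((Real.pi / b : ℝ) : ℂ) * w by push_cast; ring,
        im_ofReal_mul]
    rw [him] at h2
    rw [h3] at h1
    have h4 : 2 * K ≤ (1 + T) ^ (N + 1) := by
      have : 1 + T ≤ (1 + T) ^ (N + 1) := le_self_pow₀ (by linarith) (by simp)
      linarith
    rw [div_le_iff₀ (by positivity)]
    nlinarith
  have hq : dslope F 0 w / sinQuotient b w = (F w - F 0) / sin (Real.pi * w / b) := by
    rw [← mul_sinQuotient, dslope_of_ne _ hw0, slope_def_field, sub_zero, div_div]
  rw [hq, norm_div]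
  have hpos : 0 < (1 + T) ^ (N + 1) / (2 * K) := by positivity
  rw [div_le_iff₀ (hpos.trans_le hs)]
  refine hF.trans ((?_ : _ ≤ ε * ((1 + T) ^ (N + 1) / (2 * K))).trans (by gcongr))
  rw [div_le_iff₀ hε] at hT
  rw [← mul_div_assoc, le_div_iff₀ (by positivity), pow_succ]
  have : 0 ≤ (1 + T) ^ N := by positivity
  nlinarith [mul_nonneg this hε.le]

lemma sin_right_edge {b : ℝ} (hb : b ≠ 0) (y : ℝ) :
    sin (Real.pi * (((b / 2 : ℝ) : ℂ) + y * I) / b) = (Real.cosh (Real.pi * y / b) : ℂ) := by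
  have hb' : (b : ℂ) ≠ 0 := ofReal_ne_zero.mpr hb
  have : (Real.pi * (((b / 2 : ℝ) : ℂ) + y * I) / b : ℂ) =
      (Real.pi * y / b : ℝ) * I + Real.pi / 2 := by
    push_cast
    field_simp
    ring
  rw [this, sin_add_pi_div_two, cos_mul_I, ofReal_cosh]

lemma sin_left_edge {b : ℝ} (hb : b ≠ 0) (y : ℝ) :
    sin (Real.pi * (((-(b / 2) : ℝ) : ℂ) + y * I) / b) = -(Real.cosh (Real.pi * y / b) : ℂ) := by
  have hb' : (b : ℂ) ≠ 0 := ofReal_ne_zero.mpr hb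
  have : (Real.pi * (((-(b / 2) : ℝ) : ℂ) + y * I) / b : ℂ) =
      (Real.pi * y / b : ℝ) * I - Real.pi / 2 := by
    push_cast
    field_simp
    ring
  rw [this, sin_sub_pi_div_two, cos_mul_I, ofReal_cosh]

/-- The strip formula: a holomorphic function of polynomial growth on the closed strip
`|Re w| ≤ b / 2` is recovered at the centre from its values on the two edges. -/
theorem integral_edgeIntegrand {b : ℝ} (hb : 0 < b) {F : ℂ → ℂ}
    (hF : ∀ w : ℂ, |w.re| ≤ b / 2 → DifferentiableAt ℂ F w) (hg : StripGrowth (b / 2) F) :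
    Integrable (edgeIntegrand b F) ∧ ∫ v, edgeIntegrand b F v = 2 * b * F 0 := by
  have hb2 : |-(b / 2)| ≤ b / 2 := by rw [abs_neg, abs_of_pos (by positivity)]
  have hb2' : |b / 2| ≤ b / 2 := by rw [abs_of_pos (by positivity)]
  have h1 := integrable_edge hb (fun w hw => (hF w hw).continuousAt) hg hb2
  have h2 := integrable_edge hb (fun w hw => (hF w hw).continuousAt) hg hb2'
  obtain ⟨hi, he⟩ := integrable_and_integral_edgeIntegrand h1 h2
  refine ⟨hi, ?_⟩
  set G : ℂ → ℂ := fun w => dslope F 0 w / sinQuotient b w with hG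
  have hF0 : ∀ᶠ z in 𝓝 (0 : ℂ), DifferentiableAt ℂ F z := by
    filter_upwards [(isOpen_lt (by fun_prop : Continuous fun w : ℂ => |w.re|)
      continuous_const).mem_nhds (show (0 : ℂ) ∈ {w : ℂ | |w.re| < b / 2} by simpa using hb)]
      with w hw using hF w (le_of_lt hw)
  have hGd (w : ℂ) (hw : |w.re| ≤ b / 2) : DifferentiableAt ℂ G w :=
    (differentiableAt_dslope hF0 (hF w hw)).div (differentiable_sinQuotient b w)
      (sinQuotient_ne_zero hb (by linarith))
  have hGeq (w : ℂ) (hw : w ≠ 0) : G w = (F w - F 0) / sin (Real.pi * w / b) := by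
    simp only [hG]
    rw [← mul_sinQuotient, dslope_of_ne _ hw, slope_def_field, sub_zero, div_div]
  have hGR (y : ℝ) : G (((b / 2 : ℝ) : ℂ) + y * I) =
      (F (((b / 2 : ℝ) : ℂ) + I * y) - F 0) / (Real.cosh (Real.pi * y / b) : ℂ) := by
    rw [hGeq _ fun h => ?_, sin_right_edge hb.ne', mul_comm I]
    have := congrArg re h
    simp at this
    linarith
  have hGL (y : ℝ) : G (((-(b / 2) : ℝ) : ℂ) + y * I) =
      -((F (((-(b / 2) : ℝ) : ℂ) + I * y) - F 0) / (Real.cosh (Real.pi * y / b) : ℂ)) := by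
    rw [hGeq _ fun h => ?_, sin_left_edge hb.ne', mul_comm I, div_neg]
    have := congrArg re h
    simp at this
    linarith
  have hcosh : Integrable fun y : ℝ => F 0 / (Real.cosh (Real.pi * y / b) : ℂ) :=
    integrable_div_cosh hb (g := fun _ => F 0) continuous_const (C := ‖F 0‖) (R := 0) (N := 0)
      (by simp)
  have hR : Integrable fun y : ℝ => G (((b / 2 : ℝ) : ℂ) + y * I) := by
    simp_rw [hGR, sub_div]
    exact h2.sub hcosh
  have hL : Integrable fun y : ℝ => G (((-(b / 2) : ℝ) : ℂ) + y * I) := by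
    simp_rw [hGL, sub_div]
    exact (h1.sub hcosh).neg
  have hlim := intervalIntegral_tendsto_integral (hR.sub hL) tendsto_neg_atTop_atBot tendsto_id
  have hzero : Tendsto (fun T : ℝ => ∫ y in (-T)..T, (G (((b / 2 : ℝ) : ℂ) + y * I) -
      G (((-(b / 2) : ℝ) : ℂ) + y * I))) atTop (𝓝 0) := by
    rw [Metric.tendsto_atTop']
    intro ε hε
    -- Each horizontal side has length `b`, so it contributes at most `ε / 4`.
    obtain ⟨T₀, hT₀⟩ := eventually_atTop.mp (eventually_norm_dslope_div_le hb hg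
      (show 0 < ε / (4 * b) by positivity))
    refine ⟨max T₀ 0, fun T hT => ?_⟩
    have hT0 : 0 < T := lt_of_le_of_lt (le_max_right _ _) hT
    have hrect := integral_boundary_rect_eq_zero_of_differentiableOn G
      ⟨-(b / 2), -T⟩ ⟨b / 2, T⟩ fun w hw => (hGd w ?_).differentiableWithinAt
    swap
    · have := hw.1
      simp only [Set.mem_preimage] at this
      rw [Set.uIcc_of_le (by linarith)] at this
      exact abs_le.mpr this
    simp only at hrect
    have hbound (c : ℝ) (hc : |c| = T) : ‖∫ x : ℝ in (-(b / 2))..(b / 2), G (x + c * I)‖ ≤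
        ε / (4 * b) * b := by
      have := intervalIntegral.norm_integral_le_of_norm_le_const (a := -(b / 2)) (b := b / 2)
        (f := fun x : ℝ => G (x + c * I)) (C := ε / (4 * b)) fun x hx => ?_
      · rwa [show b / 2 - -(b / 2) = b by ring, abs_of_pos hb] at this
      · rw [Set.uIoc_of_le (by linarith)] at hx
        refine hT₀ T (le_trans (le_max_left _ _) hT.le) _ ?_ ?_
        · simpa using abs_le.mpr ⟨hx.1.le, hx.2⟩
        · simpa using hc
    have hb1 := hbound (-T) (by rw [abs_neg, abs_of_pos hT0])
    have hb2 := hbound T (abs_of_pos hT0)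
    rw [intervalIntegral.integral_sub hR.intervalIntegrable hL.intervalIntegrable, dist_zero_right]
    have heq : (∫ y : ℝ in (-T)..T, G (((b / 2 : ℝ) : ℂ) + y * I)) -
        ∫ y : ℝ in (-T)..T, G (((-(b / 2) : ℝ) : ℂ) + y * I) =
        I * ((∫ x : ℝ in (-(b / 2))..(b / 2), G (x + (-T : ℝ) * I)) -
          ∫ x : ℝ in (-(b / 2))..(b / 2), G (x + T * I)) := by
      simp only [smul_eq_mul] at hrect
      linear_combination (-I) * hrect + ((∫ y : ℝ in (-T)..T, G (((b / 2 : ℝ) : ℂ) + y * I)) -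
        ∫ y : ℝ in (-T)..T, G (((-(b / 2) : ℝ) : ℂ) + y * I)) * I_mul_I
    rw [heq, norm_mul, norm_I, one_mul]
    refine (norm_sub_le _ _).trans_lt ?_
    have : ε / (4 * b) * b = ε / 4 := by field_simp
    linarith
  have h0 := tendsto_nhds_unique hlim hzero
  have hc : ∫ y : ℝ, F 0 / (Real.cosh (Real.pi * y / b) : ℂ) = F 0 * b := by
    simp_rw [div_eq_mul_inv (F 0), ← ofReal_inv]
    rw [integral_const_mul, integral_complex_ofReal, integral_inv_cosh hb]
  have h0' := integral_sub hR hL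
  simp only [Pi.sub_apply] at h0
  rw [h0] at h0'
  simp_rw [hGR, hGL, sub_div] at h0'
  rw [integral_neg, integral_sub h1 hcosh, integral_sub h2 hcosh, hc] at h0'
  rw [he]
  linear_combination -h0'

/-! ### Simple poles off the edges -/

lemma integrable_pole_edge {b : ℝ} (hb : 0 < b) {a : ℝ} {p : ℂ} (hp : p.re ≠ a) :
    Integrable fun v : ℝ => ((a + I * v : ℂ) - p)⁻¹ / (Real.cosh (Real.pi * v / b) : ℂ) := by
  have hre (v : ℝ) : ((a + I * v : ℂ) - p).re = a - p.re := by simp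
  have hne (v : ℝ) : (a + I * v : ℂ) - p ≠ 0 := fun h => by
    have := hre v
    rw [h, zero_re] at this
    exact hp (by linarith)
  refine integrable_div_cosh hb (Continuous.inv₀ (by fun_prop) hne) (C := |a - p.re|⁻¹) (R := 0)
    (N := 0) fun v _ => ?_
  rw [pow_zero, mul_one, norm_inv]
  exact inv_anti₀ (abs_pos.mpr (sub_ne_zero.mpr hp.symm)) (hre v ▸ abs_re_le_norm _)

lemma integrable_edgeIntegrand_pole {b : ℝ} (hb : 0 < b) {p : ℂ} (hp : |p.re| ≠ b / 2) :
    Integrable (edgeIntegrand b fun w => (w - p)⁻¹) :=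
  (integrable_and_integral_edgeIntegrand (F := fun w => (w - p)⁻¹)
    (integrable_pole_edge hb fun h => hp (by rw [h, abs_neg, abs_of_pos (by positivity)]))
    (integrable_pole_edge hb fun h => hp (by rw [h, abs_of_pos (by positivity)]))).1

lemma one_le_norm_sin_of_three_le {z : ℂ} (hz : 3 ≤ |z.im|) : 1 ≤ ‖sin z‖ := by
  refine le_trans ?_ (cosh_sub_one_le_norm_sin z)
  rw [← Real.cosh_abs, Real.cosh_eq]
  linarith [Real.add_one_le_exp |z.im|, Real.exp_pos (-|z.im|)]

lemma norm_inv_sub_le_one {w p : ℂ} (h : |p.im| + 1 ≤ |w.im|) : ‖(w - p)⁻¹‖ ≤ 1 := by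
  rw [norm_inv]
  refine inv_le_one_of_one_le₀ (le_trans ?_ (abs_im_le_norm _))
  rw [sub_im]
  linarith [abs_sub_abs_le_abs_sub w.im p.im]

lemma integral_edgeIntegrand_pole_of_lt {b : ℝ} (hb : 0 < b) {p : ℂ} (hp : b / 2 < |p.re|) :
    ∫ v, edgeIntegrand b (fun w => (w - p)⁻¹) v = 2 * b * (-p⁻¹) := by
  have hd (w : ℂ) (hw : |w.re| ≤ b / 2) : DifferentiableAt ℂ (fun w => (w - p)⁻¹) w := by
    have hs : DifferentiableAt ℂ (fun w : ℂ => w - p) w := by fun_prop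
    refine hs.fun_inv fun h => ?_
    rw [sub_eq_zero.mp h] at hw
    linarith
  have hg : StripGrowth (b / 2) fun w => (w - p)⁻¹ :=
    ⟨1, 0, |p.im| + 1, fun w _ h => by simpa using norm_inv_sub_le_one h⟩
  rw [(integral_edgeIntegrand hb hd hg).2, zero_sub, inv_neg]

/-- An antiperiodic function contributes nothing to the strip formula. -/
lemma integral_edgeIntegrand_of_antiperiodic {b : ℝ} {g : ℂ → ℂ} (hg : ∀ w, g (w + b) = -g w)
    (h : Integrable fun v : ℝ => g (((-(b / 2) : ℝ) : ℂ) + I * v) /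
      (Real.cosh (Real.pi * v / b) : ℂ)) :
    Integrable (edgeIntegrand b g) ∧ ∫ v, edgeIntegrand b g v = 0 := by
  have he (v : ℝ) : g (((b / 2 : ℝ) : ℂ) + I * v) / (Real.cosh (Real.pi * v / b) : ℂ) =
      -(g (((-(b / 2) : ℝ) : ℂ) + I * v) / (Real.cosh (Real.pi * v / b) : ℂ)) := by
    rw [← neg_div, ← hg]
    push_cast
    ring_nf
  have h2 : Integrable fun v : ℝ => g (((b / 2 : ℝ) : ℂ) + I * v) /
      (Real.cosh (Real.pi * v / b) : ℂ) := by
    simp_rw [he]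
    exact h.neg
  obtain ⟨h3, h4⟩ := integrable_and_integral_edgeIntegrand h h2
  refine ⟨h3, ?_⟩
  rw [h4]
  simp_rw [he]
  rw [integral_neg, add_neg_cancel]

lemma edgeIntegrand_sub (b : ℝ) (f g : ℂ → ℂ) (v : ℝ) :
    edgeIntegrand b (fun w => f w - g w) v = edgeIntegrand b f v - edgeIntegrand b g v := by
  simp only [edgeIntegrand]
  ring

/-- The pole is cancelled by an antiperiodic function with the same principal part, which is
invisible to the edge integral but not to the value at the centre. -/
lemma integral_edgeIntegrand_pole_of_gt {b : ℝ} (hb : 0 < b) {p : ℂ} (hp : |p.re| < b / 2)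
    (hp0 : p ≠ 0) :
    ∫ v, edgeIntegrand b (fun w => (w - p)⁻¹) v =
      2 * b * (-p⁻¹ + Real.pi / (b * sin (Real.pi * p / b))) := by
  have hb' : (b : ℂ) ≠ 0 := ofReal_ne_zero.mpr hb.ne'
  set D := sinQuotient b with hD
  -- With `u = w - p` and `D 0 = π / b`, this is `(D u - D 0) / (u D u) = u⁻¹ - (π/b) / sin (π u /
  -- b)`, in a form that is visibly holomorphic at `p`.
  set F : ℂ → ℂ := fun w => dslope D 0 (w - p) / D (w - p) with hF
  set g : ℂ → ℂ := fun w => Real.pi / b / sin (Real.pi * (w - p) / b) with hg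
  have hre (w : ℂ) (hw : |w.re| ≤ b / 2) : |(w - p).re| < b := by
    rw [sub_re]
    linarith [abs_sub w.re p.re]
  have hFeq (w : ℂ) (hw : |w.re| ≤ b / 2) (h : w ≠ p) : F w = (w - p)⁻¹ - g w := by
    have h1 : w - p ≠ 0 := sub_ne_zero.mpr h
    have h2 : D (w - p) ≠ 0 := sinQuotient_ne_zero hb (hre w hw)
    simp only [hF, hg]
    rw [dslope_of_ne _ h1, slope_def_field, sub_zero, ← mul_sinQuotient, hD, sinQuotient_zero]
    rw [hD] at h2
    field_simp
  have hd (w : ℂ) (hw : |w.re| ≤ b / 2) : DifferentiableAt ℂ F w := by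
    have hs : DifferentiableAt ℂ (fun w : ℂ => w - p) w := by fun_prop
    have h1 : DifferentiableAt ℂ (dslope D 0) (w - p) :=
      differentiableAt_dslope (Eventually.of_forall (differentiable_sinQuotient b))
        (differentiable_sinQuotient b _)
    exact (h1.comp w hs).div ((differentiable_sinQuotient b _).comp w hs)
      (sinQuotient_ne_zero hb (hre w hw))
  have hgr : StripGrowth (b / 2) F := by
    -- The height `|p.im| + 1` bounds the pole by `1`; the extra `3b/π` gives the sine an argument
    -- with imaginary part at least `3` in absolute value, so its norm is at least `1`.
    refine ⟨1 + Real.pi / b, 0, |p.im| + 1 + 3 * b / Real.pi, fun w hw him => ?_⟩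
    have hpos : 0 < 3 * b / Real.pi := by positivity
    have hne : w ≠ p := by
      rintro rfl
      linarith
    rw [hFeq w hw hne, pow_zero, mul_one]
    refine (norm_sub_le _ _).trans (add_le_add (norm_inv_sub_le_one (by linarith)) ?_)
    simp only [hg]
    have h3 : 3 ≤ |(Real.pi * (w - p) / b : ℂ).im| := by
      rw [show (Real.pi * (w - p) / b : ℂ) = ((Real.pi / b : ℝ) : ℂ) * (w - p) by push_cast; ring,
        im_ofReal_mul, abs_mul, abs_of_pos (by positivity), sub_im]
      have : 3 * b / Real.pi ≤ |w.im - p.im| := by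
        linarith [abs_sub_abs_le_abs_sub w.im p.im]
      calc (3 : ℝ) = Real.pi / b * (3 * b / Real.pi) := by
            have := Real.pi_ne_zero
            field_simp
        _ ≤ _ := by gcongr
    rw [norm_div, norm_div, norm_real, norm_real, Real.norm_of_nonneg Real.pi_pos.le,
      Real.norm_of_nonneg hb.le]
    exact div_le_self (by positivity) (one_le_norm_sin_of_three_le h3)
  obtain ⟨hFi, hFint⟩ := integral_edgeIntegrand hb hd hgr
  have hbl : |-(b / 2)| = b / 2 := by rw [abs_neg, abs_of_pos (by positivity)]
  have hanti (w : ℂ) : g (w + b) = -g w := by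
    simp only [hg]
    rw [show (Real.pi * (w + b - p) / b : ℂ) = Real.pi * (w - p) / b + Real.pi by field_simp; ring,
      sin_add_pi, div_neg]
  have hnl (v : ℝ) : (((-(b / 2) : ℝ) : ℂ) + I * v) ≠ p := by
    rintro rfl
    simp only [add_re, ofReal_re, mul_re, I_re, zero_mul, I_im, ofReal_im, mul_zero, sub_zero,
      add_zero] at hp
    linarith
  have hgi : Integrable fun v : ℝ => g (((-(b / 2) : ℝ) : ℂ) + I * v) /
      (Real.cosh (Real.pi * v / b) : ℂ) := by
    have h1 := integrable_pole_edge hb (a := -(b / 2)) (p := p) fun h => by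
      rw [h] at hp
      linarith
    have h2 := integrable_edge hb (fun w hw => (hd w hw).continuousAt) hgr hbl.le
    refine (h1.sub h2).congr (Eventually.of_forall fun v => ?_)
    simp only [Pi.sub_apply]
    rw [hFeq _ (by simp [hbl]) (hnl v)]
    ring
  obtain ⟨hgi', hg0⟩ := integral_edgeIntegrand_of_antiperiodic hanti hgi
  have hpole := integrable_edgeIntegrand_pole hb hp.ne
  have hnr (v : ℝ) : ((b : ℂ) / 2 - I * v) ≠ p := by
    rintro rfl
    have : ((b : ℂ) / 2 - I * v).re = b / 2 := by
      rw [show (b : ℂ) / 2 = ((b / 2 : ℝ) : ℂ) by push_cast; rfl]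
      simp
    rw [this] at hp
    linarith [le_abs_self (b / 2)]
  have heq : edgeIntegrand b F = fun v => edgeIntegrand b (fun w => (w - p)⁻¹) v -
      edgeIntegrand b g v := by
    ext v
    rw [← edgeIntegrand_sub, edgeIntegrand, edgeIntegrand]
    have e1 : -(b : ℂ) / 2 + I * v = ((-(b / 2) : ℝ) : ℂ) + I * v := by push_cast; ring
    have e2 : (b : ℂ) / 2 - I * v = ((b / 2 : ℝ) : ℂ) + I * ((-v : ℝ) : ℂ) := by push_cast; ring
    rw [hFeq _ (by rw [e1]; simp [hbl]) (e1 ▸ hnl v),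
      hFeq _ (by rw [e2]; simp [abs_of_pos (half_pos hb)]) (hnr v)]
  rw [heq, integral_sub hpole hgi', hg0, sub_zero] at hFint
  rw [hFint, hFeq 0 (by simpa using (half_pos hb).le) hp0.symm]
  simp only [hg]
  rw [zero_sub, mul_neg, neg_div, sin_neg, inv_neg, div_neg, sub_neg_eq_add, div_div]

/-! ### Principal values -/

lemma HasPVIntegral.add {f g : ℝ → ℂ} {c : ℝ} {A B : ℂ} (hf : HasPVIntegral f c A)
    (hg : HasPVIntegral g c B) : HasPVIntegral (fun v => f v + g v) c (A + B) := by
  refine ⟨fun ε hε => (hf.1 ε hε).add (hg.1 ε hε), (hf.2.add hg.2).congr' ?_⟩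
  filter_upwards [self_mem_nhdsWithin] with ε hε
  rw [← integral_add (hf.1 ε hε) (hg.1 ε hε)]

lemma HasPVIntegral.const_mul {f : ℝ → ℂ} {c : ℝ} {A : ℂ} (hf : HasPVIntegral f c A) (a : ℂ) :
    HasPVIntegral (fun v => a * f v) c (a * A) :=
  ⟨fun ε hε => (hf.1 ε hε).const_mul a, by simpa [integral_const_mul] using hf.2.const_mul a⟩

lemma measurableSet_lt_abs_sub (ε c : ℝ) : MeasurableSet {v : ℝ | ε < |v - c|} :=
  (isOpen_lt continuous_const (by fun_prop)).measurableSet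

lemma HasPVIntegral.congr {f g : ℝ → ℂ} {c : ℝ} {A : ℂ} (hf : HasPVIntegral f c A)
    (h : ∀ v, v ≠ c → f v = g v) : HasPVIntegral g c A := by
  have heq (ε : ℝ) (hε : 0 < ε) : Set.EqOn f g {v : ℝ | ε < |v - c|} := fun v hv => by
    refine h v ?_
    rintro rfl
    simp only [sub_self, abs_zero, Set.mem_ofPred_eq] at hv
    linarith
  refine ⟨fun ε hε => (hf.1 ε hε).congr_fun (heq ε hε) (measurableSet_lt_abs_sub ε c),
    hf.2.congr' ?_⟩
  filter_upwards [self_mem_nhdsWithin] with ε hε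
  exact setIntegral_congr_fun (measurableSet_lt_abs_sub ε c) (heq ε hε)

lemma tendsto_setIntegral_lt_abs_sub {E : Type*} [NormedAddCommGroup E] [NormedSpace ℝ E]
    {f : ℝ → E} (hf : Integrable f) (c : ℝ) :
    Tendsto (fun ε : ℝ => ∫ v in {v : ℝ | ε < |v - c|}, f v) (𝓝[>] 0) (𝓝 (∫ v, f v)) := by
  simp_rw [← integral_indicator (measurableSet_lt_abs_sub _ c)]
  refine tendsto_integral_filter_of_dominated_convergence (fun v => ‖f v‖)
    (Eventually.of_forall fun ε =>
      (hf.indicator (measurableSet_lt_abs_sub ε c)).aestronglyMeasurable)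
    (Eventually.of_forall fun ε => Eventually.of_forall fun v => norm_indicator_le_norm_self _ _)
    hf.norm ?_
  have hne : ∀ᵐ v : ℝ, v ≠ c := by simp [ae_iff]
  filter_upwards [hne] with v hv
  refine tendsto_const_nhds.congr' ?_
  have : ∀ᶠ ε : ℝ in 𝓝[>] 0, ε < |v - c| :=
    nhdsWithin_le_nhds (eventually_lt_nhds (abs_pos.mpr (sub_ne_zero.mpr hv)))
  filter_upwards [this] with ε hε
  exact (Set.indicator_of_mem (show v ∈ {v : ℝ | ε < |v - c|} from hε) f).symm

lemma MeasureTheory.Integrable.hasPVIntegral {f : ℝ → ℂ} (hf : Integrable f) (c : ℝ) :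
    HasPVIntegral f c (∫ v, f v) :=
  ⟨fun _ _ => hf.integrableOn, tendsto_setIntegral_lt_abs_sub hf c⟩

/-- If the real part is integrable, its integral is the real part of the principal value. -/
lemma HasPVIntegral.integral_re {f : ℝ → ℂ} {c : ℝ} {A : ℂ} (hf : HasPVIntegral f c A)
    (hr : Integrable fun v => (f v).re) : ∫ v, (f v).re = A.re := by
  refine tendsto_nhds_unique (tendsto_setIntegral_lt_abs_sub hr c)
    (((continuous_re.tendsto A).comp hf.2).congr' ?_)
  filter_upwards [self_mem_nhdsWithin] with ε hε
  exact (_root_.integral_re (hf.1 ε hε)).symm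

lemma HasPVIntegral.comp_neg {f : ℝ → ℂ} {c : ℝ} {A : ℂ} (hf : HasPVIntegral f c A) :
    HasPVIntegral (fun v => f (-v)) (-c) A := by
  have hs (ε : ℝ) : (fun v : ℝ => Set.indicator {v : ℝ | ε < |v - -c|} (fun v => f (-v)) v) =
      fun v => Set.indicator {v : ℝ | ε < |v - c|} f (-v) := by
    ext v
    have : |v - -c| = |-v - c| := by rw [← abs_neg]; ring_nf
    simp only [Set.indicator, Set.mem_ofPred_eq, this]
  refine ⟨fun ε hε => ?_, hf.2.congr fun ε => ?_⟩
  · rw [← integrable_indicator_iff (measurableSet_lt_abs_sub ε (-c))]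
    have := (integrable_indicator_iff (measurableSet_lt_abs_sub ε c)).mpr (hf.1 ε hε)
    exact this.comp_neg.congr (Eventually.of_forall fun v => (congrFun (hs ε) v).symm)
  · rw [← integral_indicator (measurableSet_lt_abs_sub ε c),
      ← integral_indicator (measurableSet_lt_abs_sub ε (-c)), hs ε, integral_neg_eq_self]

/-! ### Odd kernels approximating `1/x` -/

/-- The symmetrized difference quotient of `φ` at `t`. -/
noncomputable def symmQuotient (φ : ℝ → ℂ) (t x : ℝ) : ℂ := (φ (t + x) - φ (t - x)) / x

/-- On `[-1, 1]` the quotient agrees off `0` with a continuous `dslope`, hence is bounded; elsewhere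
dividing by `x` only decreases an integrable function. -/
lemma integrable_symmQuotient {φ : ℝ → ℂ} {t : ℝ} (hc : Continuous φ) (hi : Integrable φ)
    (hd : DifferentiableAt ℝ φ t) : Integrable (symmQuotient φ t) := by
  set k : ℝ → ℂ := fun x => φ (t + x) - φ (t - x) with hk
  have hkd : DifferentiableAt ℝ k 0 := by
    refine DifferentiableAt.sub ?_ ?_
    · exact DifferentiableAt.comp (f := fun x : ℝ => t + x) 0 (by simpa using hd) (by fun_prop)
    · exact DifferentiableAt.comp (f := fun x : ℝ => t - x) 0 (by simpa using hd) (by fun_prop)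
  have hkc : Continuous k := by fun_prop
  have hs : ContinuousOn (dslope k 0) Set.univ :=
    (continuousOn_dslope Filter.univ_mem).mpr ⟨hkc.continuousOn, hkd⟩
  obtain ⟨C, hC⟩ := (isCompact_Icc (a := (-1 : ℝ)) (b := 1)).exists_bound_of_continuousOn
    (hs.mono (Set.subset_univ _))
  have h1 : Integrable fun x => ‖φ (t + x)‖ + ‖φ (t - x)‖ :=
    (hi.comp_add_left t).norm.add (hi.comp_sub_left t).norm
  have h2 : Integrable (Set.indicator (Set.Icc (-1 : ℝ) 1) fun _ => C) :=
    (integrable_indicator_iff measurableSet_Icc).mpr (integrableOn_const (by simp))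
  refine (h2.add h1).mono' ?_ ?_
  · exact (hkc.measurable.div measurable_ofReal).aestronglyMeasurable
  · have hne : ∀ᵐ v : ℝ, v ≠ 0 := by simp [ae_iff]
    filter_upwards [hne] with x hx
    have hk0 : k 0 = 0 := by simp [hk]
    by_cases hx1 : x ∈ Set.Icc (-1 : ℝ) 1
    · have h3 := hC x hx1
      rw [dslope_of_ne _ hx, slope_def_module, hk0, sub_zero, sub_zero] at h3
      have h4 : symmQuotient φ t x = x⁻¹ • k x := by
        rw [symmQuotient, real_smul, ofReal_inv, div_eq_inv_mul]
      rw [h4, Pi.add_apply, Set.indicator_of_mem hx1]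
      linarith [norm_nonneg (φ (t + x)), norm_nonneg (φ (t - x))]
    · rw [Pi.add_apply, Set.indicator_of_notMem hx1, zero_add, symmQuotient, norm_div, norm_real]
      have : 1 ≤ ‖x‖ := by
        rw [Real.norm_eq_abs]
        by_contra hlt
        exact hx1 (abs_le.mp (not_le.mp hlt).le)
      exact (div_le_self (norm_nonneg _) this).trans (norm_sub_le _ _)

lemma integral_odd_mul {φ : ℝ → ℂ} {t : ℝ} (hi : Integrable φ) {κ : ℝ → ℝ} (hm : Measurable κ)
    (hodd : ∀ x, κ (-x) = -κ x) {M : ℝ} (hM : ∀ x, |κ x| ≤ M) :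
    ∫ x, (κ x : ℂ) * φ (t + x) = 1 / 2 * ∫ x, ((x * κ x : ℝ) : ℂ) * symmQuotient φ t x := by
  have h1 : Integrable fun x => (κ x : ℂ) * φ (t + x) :=
    (hi.comp_add_left t).bdd_mul (c := M) (measurable_ofReal.comp hm).aestronglyMeasurable
      (Eventually.of_forall fun x => by simpa using hM x)
  have h2 : ∫ x, (κ x : ℂ) * φ (t + x) = ∫ x, -((κ x : ℂ) * φ (t - x)) := by
    rw [← integral_neg_eq_self]
    simp only [hodd, ofReal_neg, neg_mul, sub_eq_add_neg]
  have h3 : Integrable fun x => -((κ x : ℂ) * φ (t - x)) := by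
    have := h1.comp_neg
    simpa only [hodd, ofReal_neg, neg_mul, sub_eq_add_neg] using this
  have h4 : ∫ x, ((x * κ x : ℝ) : ℂ) * symmQuotient φ t x =
      ∫ x, ((κ x : ℂ) * φ (t + x) + -((κ x : ℂ) * φ (t - x))) := by
    refine integral_congr_ae ?_
    have hne : ∀ᵐ v : ℝ, v ≠ 0 := by simp [ae_iff]
    filter_upwards [hne] with x hx
    have hx' : (x : ℂ) ≠ 0 := ofReal_ne_zero.mpr hx
    rw [symmQuotient]
    push_cast
    field_simp
    ring
  rw [h4, integral_add h1 h3, ← h2]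
  ring

/-- Symmetrization replaces the singular kernel by the weight `x κ(x)`, bounded by `1`, so dominated
convergence applies. The limit does not depend on the kernel: sharp truncation and smoothing of
`1/x` therefore give the same value. -/
lemma tendsto_integral_odd_mul {φ : ℝ → ℂ} {t : ℝ} (hi : Integrable φ)
    (hs : Integrable (symmQuotient φ t)) {κ : ℝ → ℝ → ℝ}
    (hm : ∀ ε, Measurable (κ ε)) (hodd : ∀ ε x, κ ε (-x) = -κ ε x)
    (hM : ∀ ε > 0, ∃ M, ∀ x, |κ ε x| ≤ M) (h1 : ∀ ε x, |x * κ ε x| ≤ 1)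
    (hlim : ∀ x, x ≠ 0 → Tendsto (fun ε => x * κ ε x) (𝓝[>] 0) (𝓝 1)) :
    Tendsto (fun ε => ∫ x, (κ ε x : ℂ) * φ (t + x)) (𝓝[>] 0)
      (𝓝 (1 / 2 * ∫ x, symmQuotient φ t x)) := by
  have h2 : Tendsto (fun ε => ∫ x, ((x * κ ε x : ℝ) : ℂ) * symmQuotient φ t x) (𝓝[>] 0)
      (𝓝 (∫ x, symmQuotient φ t x)) := by
    refine tendsto_integral_filter_of_dominated_convergence (fun x => ‖symmQuotient φ t x‖)
      (Eventually.of_forall fun ε => ?_) (Eventually.of_forall fun ε => Eventually.of_forall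
      fun x => ?_) hs.norm ?_
    · exact (measurable_ofReal.comp (measurable_id.mul (hm ε))).aestronglyMeasurable.mul
        hs.aestronglyMeasurable
    · rw [norm_mul, norm_real]
      exact mul_le_of_le_one_left (norm_nonneg _) (h1 ε x)
    · have hne : ∀ᵐ v : ℝ, v ≠ 0 := by simp [ae_iff]
      filter_upwards [hne] with x hx
      have := ((continuous_ofReal.tendsto 1).comp (hlim x hx)).mul_const (symmQuotient φ t x)
      simpa using this
  refine (h2.const_mul (1 / 2)).congr' ?_
  filter_upwards [self_mem_nhdsWithin] with ε hε
  obtain ⟨M, hM'⟩ := hM ε hε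
  exact (integral_odd_mul hi (hm ε) (hodd ε) hM').symm

lemma hasPVIntegral_div_sub {φ : ℝ → ℂ} {t : ℝ} (hi : Integrable φ)
    (hs : Integrable (symmQuotient φ t)) :
    HasPVIntegral (fun v => φ v / ((v : ℂ) - t)) t (1 / 2 * ∫ x, symmQuotient φ t x) := by
  set κ : ℝ → ℝ → ℝ := fun ε x => if ε < |x| then x⁻¹ else 0 with hκ
  have hset (ε : ℝ) : MeasurableSet {x : ℝ | ε < |x|} :=
    (isOpen_lt continuous_const continuous_abs).measurableSet
  have hm (ε : ℝ) : Measurable (κ ε) := Measurable.ite (hset ε) measurable_inv measurable_const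
  have hM (ε : ℝ) (hε : 0 < ε) (x : ℝ) : |κ ε x| ≤ ε⁻¹ := by
    simp only [hκ]
    split_ifs with h
    · rw [abs_inv]
      exact inv_anti₀ hε h.le
    · simpa using hε.le
  have hind (ε : ℝ) : Set.indicator {v : ℝ | ε < |v - t|} (fun v => φ v / ((v : ℂ) - t)) =
      fun v => (κ ε (v - t) : ℂ) * φ v := by
    ext v
    simp only [Set.indicator, hκ, Set.mem_ofPred_eq]
    split_ifs
    · push_cast
      rw [div_eq_inv_mul]
    · simp
  refine ⟨fun ε hε => ?_, (tendsto_integral_odd_mul hi hs hm ?_ ?_ ?_ ?_).congr fun ε => ?_⟩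
  · rw [← integrable_indicator_iff (measurableSet_lt_abs_sub ε t), hind]
    exact hi.bdd_mul (c := ε⁻¹) (measurable_ofReal.comp
      ((hm ε).comp (measurable_id.sub_const t))).aestronglyMeasurable
      (Eventually.of_forall fun x => by simpa using hM ε hε (x - t))
  · intro ε x
    simp only [hκ, abs_neg]
    split_ifs
    · rw [inv_neg]
    · rw [neg_zero]
  · exact fun ε hε => ⟨ε⁻¹, hM ε hε⟩
  · intro ε x
    simp only [hκ]
    split_ifs
    -- The point `x = 0` reaches this branch when `ε < 0`; there `0⁻¹ = 0`.
    · rcases eq_or_ne x 0 with rfl | hx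
      · simp
      · rw [mul_inv_cancel₀ hx, abs_one]
    · simp
  · intro x hx
    refine tendsto_const_nhds.congr' ?_
    have : ∀ᶠ ε : ℝ in 𝓝[>] 0, ε < |x| :=
      nhdsWithin_le_nhds (eventually_lt_nhds (abs_pos.mpr hx))
    filter_upwards [this] with ε hε
    simp only [hκ, if_pos hε, mul_inv_cancel₀ hx]
  · rw [← integral_indicator (measurableSet_lt_abs_sub ε t), hind,
      ← integral_add_left_eq_self (fun v => (κ ε (v - t) : ℂ) * φ v) t]
    simp only [add_sub_cancel_left]

/-- The kernel is the conjugate Poisson kernel, which appears when poles displaced to either side of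
the edge are averaged. -/
lemma tendsto_integral_smoothed {φ : ℝ → ℂ} {t : ℝ} (hi : Integrable φ)
    (hs : Integrable (symmQuotient φ t)) :
    Tendsto (fun δ : ℝ => ∫ v : ℝ, (((v - t) / ((v - t) ^ 2 + δ ^ 2) : ℝ) : ℂ) * φ v) (𝓝[>] 0)
      (𝓝 (1 / 2 * ∫ x, symmQuotient φ t x)) := by
  refine (tendsto_integral_odd_mul hi hs (κ := fun δ x => x / (x ^ 2 + δ ^ 2)) ?_ ?_ ?_ ?_
    ?_).congr fun δ => ?_
  · intro δ
    fun_prop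
  · intro δ x
    rw [neg_sq, neg_div]
  · intro δ hδ
    refine ⟨δ⁻¹, fun x => ?_⟩
    rw [abs_div, abs_of_pos (by positivity : 0 < x ^ 2 + δ ^ 2), div_le_iff₀ (by positivity),
      ← div_eq_inv_mul, le_div_iff₀ hδ, ← sq_abs x]
    nlinarith [sq_nonneg (|x| - δ), abs_nonneg x, sq_nonneg δ]
  · intro δ x
    rw [← mul_div_assoc, ← sq, abs_of_nonneg (by positivity)]
    exact div_le_one_of_le₀ (by linarith [sq_nonneg δ]) (by positivity)
  · intro x hx
    have hc : ContinuousAt (fun δ : ℝ => x * (x / (x ^ 2 + δ ^ 2))) 0 := by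
      refine continuousAt_const.mul (continuousAt_const.div (by fun_prop) ?_)
      positivity
    have := hc.tendsto.mono_left (nhdsWithin_le_nhds (s := Set.Ioi 0))
    convert this using 2
    field_simp
    simp
  · rw [← integral_add_left_eq_self
      (fun v : ℝ => (((v - t) / ((v - t) ^ 2 + δ ^ 2) : ℝ) : ℂ) * φ v) t]
    simp only [add_sub_cancel_left]

/-! ### A simple pole on the edge -/

/-- The hyperbolic secant `v ↦ 1 / cosh (π v)`. -/
noncomputable def sechPi (v : ℝ) : ℂ := ((Real.cosh (Real.pi * v / (1 : ℝ)) : ℝ) : ℂ)⁻¹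

lemma integrable_sechPi : Integrable sechPi := by
  refine (integrable_div_cosh one_pos (g := fun _ => 1) continuous_const (C := 1) (R := 0) (N := 0)
    (by simp)).congr (Eventually.of_forall fun v => ?_)
  exact one_div _

lemma differentiable_sechPi : Differentiable ℝ sechPi := fun v =>
  (HasDerivAt.ofReal_comp (f := fun v : ℝ => Real.cosh (Real.pi * v / (1 : ℝ)))
    (DifferentiableAt.hasDerivAt (by fun_prop))).differentiableAt.inv
    (ofReal_ne_zero.mpr (Real.cosh_pos _).ne')

lemma integrable_symmQuotient_sechPi (t : ℝ) : Integrable (symmQuotient sechPi t) :=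
  integrable_symmQuotient differentiable_sechPi.continuous integrable_sechPi
    (differentiable_sechPi t)

/-- The left edge contribution of a simple pole at `p`, for the strip of width one. -/
noncomputable def leftPole (p : ℂ) (v : ℝ) : ℂ :=
  ((((-(1 / 2) : ℝ) : ℂ) + I * v) - p)⁻¹ / (Real.cosh (Real.pi * v / (1 : ℝ)) : ℂ)

lemma integrable_leftPole {p : ℂ} (hp : p.re ≠ -(1 / 2)) : Integrable (leftPole p) :=
  integrable_pole_edge one_pos hp

/-- The pole is at distance `1` from the left edge; a shift of size below `1/2` keeps it at distance
at least `1/2`, so `2 sech` dominates. -/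
lemma tendsto_integral_leftPole {p : ℂ} (hp : p.re = 1 / 2) :
    Tendsto (fun s : ℝ => ∫ v, leftPole (p + s) v) (𝓝 0) (𝓝 (∫ v, leftPole p v)) := by
  have hre (s v : ℝ) : ((((-(1 / 2) : ℝ) : ℂ) + I * v) - (p + s)).re = -(1 + s) := by
    simp only [sub_re, add_re, ofReal_re, mul_re, I_re, zero_mul, I_im, ofReal_im, mul_zero,
      sub_zero, hp]
    ring
  have hsmall : ∀ᶠ s : ℝ in 𝓝 0, |s| < 1 / 2 :=
    (isOpen_lt continuous_abs continuous_const).mem_nhds (by simp)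
  have : ContinuousAt (fun s : ℝ => ∫ v, leftPole (p + s) v) 0 := by
    refine continuousAt_of_dominated (bound := fun v => 2 * ‖sechPi v‖) ?_ ?_
      (integrable_sechPi.norm.const_mul 2) (Eventually.of_forall fun v => ?_)
    · filter_upwards [hsmall] with s hs
      refine (integrable_leftPole ?_).aestronglyMeasurable
      rw [add_re, ofReal_re, hp]
      linarith [neg_abs_le s]
    · filter_upwards [hsmall] with s hs
      refine Eventually.of_forall fun v => ?_
      rw [leftPole, div_eq_mul_inv, norm_mul, ← sechPi]
      gcongr
      rw [norm_inv, inv_le_comm₀ _ two_pos]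
      · refine le_trans ?_ (abs_re_le_norm _)
        rw [hre, abs_neg]
        refine le_trans ?_ (le_abs_self _)
        linarith [neg_abs_le s]
      · rw [norm_pos_iff]
        intro h
        have := hre s v
        rw [h, zero_re] at this
        linarith [neg_abs_le s]
    · refine ContinuousAt.div_const (ContinuousAt.inv₀ (by fun_prop) fun h => ?_) _
      have := hre 0 v
      rw [h, zero_re] at this
      linarith
  simpa using this.tendsto

/-- The two Poisson kernels `±δ / (x² + δ²)`, which would concentrate at the pole, cancel; only the
odd part survives. -/
lemma inv_average {x δ : ℝ} (hδ : 0 < δ) :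
    1 / 2 * (((δ : ℂ) - I * x)⁻¹ + (-(δ : ℂ) - I * x)⁻¹) = I * ((x / (x ^ 2 + δ ^ 2) : ℝ) : ℂ) := by
  have hC : ((x : ℂ) ^ 2 + (δ : ℂ) ^ 2) ≠ 0 := by
    have : x ^ 2 + δ ^ 2 ≠ 0 := by positivity
    exact_mod_cast this
  have h1 : ((δ : ℂ) - I * x)⁻¹ = (δ + I * x) / ((x : ℂ) ^ 2 + (δ : ℂ) ^ 2) := by
    refine inv_eq_of_mul_eq_one_right ?_
    rw [← mul_div_assoc, div_eq_one_iff_eq hC]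
    linear_combination (-(x : ℂ) ^ 2) * I_sq
  have h2 : (-(δ : ℂ) - I * x)⁻¹ = (-δ + I * x) / ((x : ℂ) ^ 2 + (δ : ℂ) ^ 2) := by
    refine inv_eq_of_mul_eq_one_right ?_
    rw [← mul_div_assoc, div_eq_one_iff_eq hC]
    linear_combination (-(x : ℂ) ^ 2) * I_sq
  rw [h1, h2]
  push_cast
  field_simp
  ring

lemma edgeIntegrand_one_pole (p : ℂ) (v : ℝ) :
    edgeIntegrand 1 (fun w => (w - p)⁻¹) v =
      leftPole p v + (1 / 2 - I * v - p)⁻¹ * sechPi v := by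
  rw [edgeIntegrand, leftPole, sechPi]
  push_cast
  ring_nf

/-- As `sech` is real, the singular term is purely imaginary. This is why the real part of the
integrand stays integrable in the boundary case. -/
lemma right_edge_pole (t v : ℝ) :
    (1 / 2 - I * v - (1 / 2 - I * t) : ℂ)⁻¹ * sechPi v = I * (sechPi v / ((v : ℂ) - t)) := by
  rw [show (1 / 2 - I * v - (1 / 2 - I * t) : ℂ) = -I * ((v : ℂ) - t) by ring, mul_inv, inv_neg,
    inv_I, neg_neg]
  ring

lemma half_sub_I_mul_re (t : ℝ) : (1 / 2 - I * t : ℂ).re = 1 / 2 := by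
  rw [show (1 / 2 : ℂ) = ((1 / 2 : ℝ) : ℂ) by push_cast; rfl]
  simp

lemma half_sub_I_mul_ne_zero (t : ℝ) : (1 / 2 - I * t : ℂ) ≠ 0 := fun h => by
  have := half_sub_I_mul_re t
  rw [h, zero_re] at this
  norm_num at this

/-- A simple pole on the edge of the strip contributes half of its residue. -/
theorem hasPVIntegral_edgeIntegrand_pole (t : ℝ) :
    HasPVIntegral (edgeIntegrand 1 fun w => (w - (1 / 2 - I * t))⁻¹) t
      (2 * (-(1 / 2 - I * t : ℂ)⁻¹) + Real.pi / sin (Real.pi * (1 / 2 - I * t))) := by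
  set p : ℂ := 1 / 2 - I * t with hp
  have hpre : p.re = 1 / 2 := half_sub_I_mul_re t
  have hp0 : p ≠ 0 := half_sub_I_mul_ne_zero t
  have hsin : sin (Real.pi * p) ≠ 0 := by
    have := sin_pi_mul_div_ne_zero one_pos (w := p) (by rw [hpre]; norm_num [abs_of_pos]) hp0
    simpa using this
  have hL : Integrable (leftPole p) := integrable_leftPole (by rw [hpre]; norm_num)
  set J : ℂ := 1 / 2 * ∫ x, symmQuotient sechPi t x with hJ
  have hPV : HasPVIntegral (edgeIntegrand 1 fun w => (w - p)⁻¹) t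
      ((∫ v, leftPole p v) + I * J) := by
    refine ((hL.hasPVIntegral t).add ((hasPVIntegral_div_sub integrable_sechPi
      (integrable_symmQuotient_sechPi t)).const_mul I)).congr fun v _ => ?_
    rw [edgeIntegrand_one_pole, hp, right_edge_pole]
  -- The value is found by averaging the formulas for `p - δ` (inside) and `p + δ` (outside) and
  -- letting `δ → 0⁺`.
  suffices h : (∫ v, leftPole p v) + I * J = 2 * (-p⁻¹) + Real.pi / sin (Real.pi * p) from h ▸ hPV
  have hT : Tendsto (fun s : ℝ => ∫ v, leftPole (p + s) v) (𝓝[>] 0) (𝓝 (∫ v, leftPole p v)) :=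
    (tendsto_integral_leftPole hpre).mono_left nhdsWithin_le_nhds
  have hT' : Tendsto (fun s : ℝ => ∫ v, leftPole (p + (-s : ℝ)) v) (𝓝[>] 0)
      (𝓝 (∫ v, leftPole p v)) := by
    refine (tendsto_integral_leftPole hpre).comp ?_
    have : Tendsto (fun s : ℝ => -s) (𝓝 0) (𝓝 0) := by simpa using (continuous_neg.tendsto (0 : ℝ))
    exact this.mono_left nhdsWithin_le_nhds
  have hlim1 := ((hT.add hT').const_mul (1 / 2)).add ((tendsto_integral_smoothed integrable_sechPi
    (integrable_symmQuotient_sechPi t)).const_mul I)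
  have hlim2 : Tendsto (fun δ : ℝ => -(p + (-δ : ℝ))⁻¹ + Real.pi / sin (Real.pi * (p + (-δ : ℝ))) +
      -(p + δ)⁻¹) (𝓝[>] 0) (𝓝 (-p⁻¹ + Real.pi / sin (Real.pi * p) + -p⁻¹)) := by
    have : ContinuousAt (fun δ : ℝ => -(p + (-δ : ℝ))⁻¹ +
        Real.pi / sin (Real.pi * (p + (-δ : ℝ))) + -(p + δ)⁻¹) 0 := by
      refine ContinuousAt.add (ContinuousAt.add ?_ ?_) ?_
      · exact (ContinuousAt.inv₀ (by fun_prop) (by simpa using hp0)).neg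
      · exact ContinuousAt.div (by fun_prop) (by fun_prop) (by simpa using hsin)
      · exact (ContinuousAt.inv₀ (by fun_prop) (by simpa using hp0)).neg
    have h := this.tendsto.mono_left (nhdsWithin_le_nhds (s := Set.Ioi 0))
    simpa using h
  have heq : ∀ᶠ δ : ℝ in 𝓝[>] 0, -(p + (-δ : ℝ))⁻¹ +
      Real.pi / sin (Real.pi * (p + (-δ : ℝ))) + -(p + δ)⁻¹ =
      1 / 2 * ((∫ v, leftPole (p + δ) v) + ∫ v, leftPole (p + (-δ : ℝ)) v) +
        I * ∫ v : ℝ, (((v - t) / ((v - t) ^ 2 + δ ^ 2) : ℝ) : ℂ) * sechPi v := by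
    have hsmall : ∀ᶠ δ : ℝ in 𝓝[>] 0, δ < 1 / 2 :=
      nhdsWithin_le_nhds (eventually_lt_nhds (by norm_num))
    filter_upwards [self_mem_nhdsWithin, hsmall] with δ hδ hδ'
    have hδ0 : 0 < δ := hδ
    have hre1 : (p + (-δ : ℝ)).re = 1 / 2 - δ := by rw [add_re, ofReal_re, hpre]; ring
    have hre2 : (p + δ).re = 1 / 2 + δ := by rw [add_re, ofReal_re, hpre]
    have ha1 : |(p + (-δ : ℝ)).re| < 1 / 2 := by
      rw [hre1, abs_lt]
      constructor <;> linarith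
    have ha2 : 1 / 2 < |(p + δ).re| := by
      rw [hre2]
      exact lt_of_lt_of_le (by linarith) (le_abs_self _)
    have hne : p + (-δ : ℝ) ≠ 0 := fun h => by
      rw [h, zero_re] at hre1
      linarith
    have hi1 := integral_edgeIntegrand_pole_of_gt one_pos ha1 hne
    have hi2 := integral_edgeIntegrand_pole_of_lt one_pos ha2
    have hE1 := integrable_edgeIntegrand_pole one_pos ha1.ne
    have hE2 := integrable_edgeIntegrand_pole one_pos ha2.ne'
    have hL1 : Integrable (leftPole (p + (-δ : ℝ))) :=
      integrable_leftPole (by rw [hre1]; linarith)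
    have hL2 : Integrable (leftPole (p + δ)) := integrable_leftPole (by rw [hre2]; linarith)
    have hpt (v : ℝ) : I * ((((v - t) / ((v - t) ^ 2 + δ ^ 2) : ℝ) : ℂ) * sechPi v) =
        1 / 2 * ((edgeIntegrand 1 (fun w => (w - (p + (-δ : ℝ)))⁻¹) v +
          edgeIntegrand 1 (fun w => (w - (p + δ))⁻¹) v) -
          (leftPole (p + δ) v + leftPole (p + (-δ : ℝ)) v)) := by
      rw [edgeIntegrand_one_pole, edgeIntegrand_one_pole, ← mul_assoc, ← inv_average hδ0,
        show (1 / 2 - I * v - (p + (-δ : ℝ)) : ℂ) = (δ : ℂ) - I * ((v - t : ℝ) : ℂ) by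
          rw [hp]; push_cast; ring,
        show (1 / 2 - I * v - (p + δ) : ℂ) = -(δ : ℂ) - I * ((v - t : ℝ) : ℂ) by
          rw [hp]; push_cast; ring]
      ring
    rw [← integral_const_mul]
    simp_rw [hpt]
    have hE : Integrable fun v => edgeIntegrand 1 (fun w => (w - (p + (-δ : ℝ)))⁻¹) v +
        edgeIntegrand 1 (fun w => (w - (p + δ))⁻¹) v := hE1.add hE2
    have hLL : Integrable fun v => leftPole (p + δ) v + leftPole (p + (-δ : ℝ)) v := hL2.add hL1
    rw [integral_const_mul, integral_sub hE hLL, integral_add hE1 hE2, integral_add hL2 hL1, hi1,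
      hi2]
    push_cast
    rw [div_one, one_mul]
    ring
  have := tendsto_nhds_unique hlim1 (hlim2.congr' heq)
  linear_combination this

/-! ### Application to the zeta function -/

lemma bIntegrand_eq_edgeIntegrand (t b v : ℝ) :
    bIntegrand t b v = edgeIntegrand b (fun w => riemannZeta (1 / 2 + I * t + w)) v := by
  rw [bIntegrand, edgeIntegrand]
  ring_nf

/-- Changing the sign of `b` merely exchanges the two edges. -/
lemma bIntegrand_neg (t b v : ℝ) : bIntegrand t (-b) v = bIntegrand t b (-v) := by
  rw [bIntegrand, bIntegrand, mul_neg, div_neg, neg_div, add_comm]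
  push_cast
  ring_nf

lemma riemannZeta_half_add {t : ℝ} {w : ℂ} (hw : w ≠ 1 / 2 - I * t) :
    riemannZeta (1 / 2 + I * t + w) =
      (w - (1 / 2 - I * t))⁻¹ + riemannZeta₀ (1 / 2 + I * t + w) := by
  rw [riemannZeta_eq_inv_sub_add fun h => hw (by linear_combination h)]
  ring_nf

lemma stripGrowth_riemannZeta₀ (s : ℂ) (β : ℝ) :
    StripGrowth β fun w => riemannZeta₀ (s + w) := by
  obtain ⟨C, N, hC⟩ := exists_norm_riemannZeta₀_le (s.re - β)
  -- From `1 + ‖s + w‖ ≤ (1 + ‖s‖ + |β|) (1 + |Im w|)` in the strip.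
  refine ⟨|C| * (1 + ‖s‖ + |β|) ^ N, N, 0, fun w hw _ => ?_⟩
  refine (hC (s + w) ?_).trans ?_
  · rw [add_re]
    linarith [neg_abs_le w.re]
  · rw [mul_assoc, ← mul_pow]
    gcongr
    · exact le_abs_self C
    · have h1 := norm_add_le s w
      have h2 := norm_le_abs_re_add_abs_im w
      have h3 := le_abs_self β
      nlinarith [norm_nonneg s, abs_nonneg w.im, abs_nonneg β]

lemma edgeIntegrand_add (b : ℝ) (f g : ℂ → ℂ) (v : ℝ) :
    edgeIntegrand b (fun w => f w + g w) v = edgeIntegrand b f v + edgeIntegrand b g v := by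
  simp only [edgeIntegrand]
  ring

lemma bIntegrand_eq_add {t b v : ℝ} (h1 : (-(b : ℂ) / 2 + I * v) ≠ 1 / 2 - I * t)
    (h2 : ((b : ℂ) / 2 - I * v) ≠ 1 / 2 - I * t) :
    bIntegrand t b v = edgeIntegrand b (fun w => (w - (1 / 2 - I * t))⁻¹) v +
      edgeIntegrand b (fun w => riemannZeta₀ (1 / 2 + I * t + w)) v := by
  rw [bIntegrand_eq_edgeIntegrand, ← edgeIntegrand_add]
  simp only [edgeIntegrand]
  rw [riemannZeta_half_add h1, riemannZeta_half_add h2]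

lemma riemannZeta_half (t : ℝ) : riemannZeta (1 / 2 + I * t) =
    -(1 / 2 - I * t : ℂ)⁻¹ + riemannZeta₀ (1 / 2 + I * t + 0) := by
  have := riemannZeta_half_add (t := t) (half_sub_I_mul_ne_zero t).symm
  rw [zero_sub, inv_neg] at this
  rw [← this, add_zero]

lemma edge_ne_pole {b : ℝ} (hb : 0 < b) (hb1 : b ≠ 1) (t v : ℝ) :
    (-(b : ℂ) / 2 + I * v) ≠ 1 / 2 - I * t ∧ ((b : ℂ) / 2 - I * v) ≠ 1 / 2 - I * t := by
  have e1 : (-(b : ℂ) / 2 + I * v) = ((-b / 2 : ℝ) : ℂ) + I * v := by push_cast; ring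
  have e2 : ((b : ℂ) / 2 - I * v) = ((b / 2 : ℝ) : ℂ) - I * v := by push_cast; ring
  constructor <;> intro h <;> have := congrArg re h <;> rw [half_sub_I_mul_re] at this
  · rw [e1] at this
    simp at this
    linarith
  · rw [e2] at this
    simp at this
    exact hb1 (by linarith)

/-- The formula off the boundary case, for positive width. -/
lemma integral_bIntegrand {b : ℝ} (hb : 0 < b) (hb1 : b ≠ 1) (t : ℝ) :
    Integrable (bIntegrand t b) ∧ ∫ v, bIntegrand t b v =
      2 * b * (riemannZeta (1 / 2 + I * t) + (if 1 < b then 1 else 0) *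
        (Real.pi / (b * sin (Real.pi * (1 / 2 - I * t) / b)))) := by
  obtain ⟨hZi, hZ⟩ := integral_edgeIntegrand hb
    (F := fun w => riemannZeta₀ (1 / 2 + I * t + w))
    (fun w _ => (differentiable_riemannZeta₀ _).comp w (by fun_prop))
    (stripGrowth_riemannZeta₀ _ _)
  have hre : |(1 / 2 - I * t : ℂ).re| = 1 / 2 := by
    rw [half_sub_I_mul_re, abs_of_pos (by norm_num)]
  have hP := integrable_edgeIntegrand_pole hb (p := 1 / 2 - I * t)
    (by rw [hre]; exact fun h => hb1 (by linarith))
  have heq : bIntegrand t b = fun v => edgeIntegrand b (fun w => (w - (1 / 2 - I * t))⁻¹) v +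
      edgeIntegrand b (fun w => riemannZeta₀ (1 / 2 + I * t + w)) v := by
    ext v
    exact bIntegrand_eq_add (edge_ne_pole hb hb1 t v).1 (edge_ne_pole hb hb1 t v).2
  rw [heq]
  refine ⟨hP.add hZi, ?_⟩
  rw [integral_add hP hZi, hZ, riemannZeta_half]
  split_ifs with h
  · rw [integral_edgeIntegrand_pole_of_gt hb (by rw [hre]; linarith) (half_sub_I_mul_ne_zero t)]
    ring
  · have : b < 1 := lt_of_le_of_ne (not_lt.mp h) hb1
    rw [integral_edgeIntegrand_pole_of_lt hb (by rw [hre]; linarith)]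
    ring

/-- The formula in the boundary case, as a principal value. -/
lemma hasPVIntegral_bIntegrand_one (t : ℝ) :
    HasPVIntegral (bIntegrand t 1) t (2 * riemannZeta (1 / 2 + I * t) +
      Real.pi / sin (Real.pi * (1 / 2 - I * t))) ∧
    Integrable fun v => (bIntegrand t 1 v).re := by
  obtain ⟨hZi, hZ⟩ := integral_edgeIntegrand one_pos
    (F := fun w => riemannZeta₀ (1 / 2 + I * t + w))
    (fun w _ => (differentiable_riemannZeta₀ _).comp w (by fun_prop))
    (stripGrowth_riemannZeta₀ _ _)
  have heq (v : ℝ) (hv : v ≠ t) : edgeIntegrand 1 (fun w => (w - (1 / 2 - I * t))⁻¹) v +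
      edgeIntegrand 1 (fun w => riemannZeta₀ (1 / 2 + I * t + w)) v = bIntegrand t 1 v := by
    refine (bIntegrand_eq_add (fun h => ?_) fun h => hv ?_).symm
    · have := congrArg re h
      rw [half_sub_I_mul_re, show (-((1 : ℝ) : ℂ) / 2 + I * v) = ((-1 / 2 : ℝ) : ℂ) + I * v by
        push_cast; ring] at this
      simp at this
      linarith
    · have := congrArg im h
      rw [show (((1 : ℝ) : ℂ) / 2 - I * v) = ((1 / 2 : ℝ) : ℂ) - I * v by push_cast; ring,
        show ((1 : ℂ) / 2 - I * t) = ((1 / 2 : ℝ) : ℂ) - I * t by push_cast; ring] at this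
      simpa using this
  constructor
  · have := ((hasPVIntegral_edgeIntegrand_pole t).add (hZi.hasPVIntegral t)).congr heq
    convert this using 1
    rw [hZ, riemannZeta_half]
    push_cast
    ring
  · have hL : Integrable (leftPole (1 / 2 - I * t)) :=
      integrable_leftPole (by rw [half_sub_I_mul_re]; norm_num)
    -- The right-edge pole term has zero real part, so only the left-edge pole and the entire part
    -- remain.
    refine (hL.re.add hZi.re).congr ?_
    have hne : ∀ᵐ v : ℝ, v ≠ t := by simp [ae_iff]
    filter_upwards [hne] with v hv
    have h0 : (I * (sechPi v / ((v : ℂ) - t))).re = 0 := by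
      rw [sechPi, ← ofReal_inv, ← ofReal_sub, ← ofReal_div, mul_comm, re_ofReal_mul, I_re, mul_zero]
    rw [← heq v hv, edgeIntegrand_one_pole, right_edge_pole, add_re, add_re, h0, add_zero]
    rfl

lemma poleWeight_symm (b : ℝ) : poleWeight ((1 - b) / 2) b =
    if 1 < |b| then 1 else if |b| = 1 then 1 / 2 else 0 := by
  rw [poleWeight, show (1 - b) / 2 + b = (1 + b) / 2 by ring]
  have h1 : min ((1 - b) / 2) ((1 + b) / 2) < 1 ∧ 1 < max ((1 - b) / 2) ((1 + b) / 2) ↔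
      1 < |b| := by
    rw [min_lt_iff, lt_max_iff, lt_abs]
    grind
  have h2 : ((1 - b) / 2 = 1 ∨ (1 + b) / 2 = 1) ↔ |b| = 1 := by
    rw [abs_eq zero_le_one]
    grind
  simp only [h1, h2]

lemma bDenominator_eq (t b : ℝ) :
    bDenominator t b = I * sin (Real.pi * (1 / 2 - I * t) / b) := by
  have : (Real.pi * (1 / 2 - I * t) / b : ℂ) =
      ((Real.pi / (2 * b) : ℝ) : ℂ) - ((Real.pi * t / b : ℝ) : ℂ) * I := by
    push_cast
    rcases eq_or_ne (b : ℂ) 0 with h | h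
    · simp [h]
    · field_simp
  rw [this, Complex.sin_sub, cos_mul_I, sin_mul_I, bDenominator]
  simp only [ofReal_cos, ofReal_sin, ofReal_cosh, ofReal_sinh]
  linear_combination (cos ((Real.pi / (2 * b) : ℝ) : ℂ) * sinh ((Real.pi * t / b : ℝ) : ℂ)) *
    I_sq

/-- The denominator is odd in `b`, so the residue term is even, matching the symmetry of the
integral. -/
lemma bDenominator_mul_neg (t b : ℝ) : bDenominator t (-b) * ((-b : ℝ) : ℂ) =
    bDenominator t b * b := by
  rw [bDenominator_eq, bDenominator_eq, ofReal_neg, div_neg, sin_neg]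
  ring

lemma bDenominator_ne_zero {b : ℝ} (hb : 1 ≤ b) (t : ℝ) : bDenominator t b ≠ 0 := by
  rw [bDenominator_eq]
  refine mul_ne_zero I_ne_zero (sin_pi_mul_div_ne_zero (by linarith) ?_ (half_sub_I_mul_ne_zero t))
  rw [half_sub_I_mul_re, abs_of_pos (by norm_num)]
  linarith

lemma exists_bIntegrand_formula_of_pos (t : ℝ) {b : ℝ} (hb : 0 < b) :
    ∃ J : ℂ,
      HasPVIntegral (bIntegrand t b) (b * t) J ∧
      Integrable (fun v : ℝ => (bIntegrand t b v).re) ∧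
      (b ≠ 1 → Integrable (bIntegrand t b) ∧ ∫ v : ℝ, bIntegrand t b v = J) ∧
      riemannZeta (1 / 2 + I * (t : ℂ)) =
        1 / (2 * (b : ℂ)) * J -
          I * (Real.pi : ℂ) * (poleWeight ((1 - b) / 2) b : ℂ) / (bDenominator t b * (b : ℂ)) := by
  have hb' : (b : ℂ) ≠ 0 := ofReal_ne_zero.mpr hb.ne'
  have hterm (H : ℂ) : I * (Real.pi : ℂ) * H / (bDenominator t b * (b : ℂ)) =
      H * (Real.pi / (b * sin (Real.pi * (1 / 2 - I * t) / b))) := by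
    rw [bDenominator_eq, mul_assoc, mul_assoc, mul_div_mul_left _ _ I_ne_zero]
    ring
  rw [poleWeight_symm, abs_of_pos hb, hterm]
  rcases eq_or_ne b 1 with rfl | hb1
  · obtain ⟨h1, h2⟩ := hasPVIntegral_bIntegrand_one t
    refine ⟨_, (by rw [one_mul]; exact h1), h2, fun h => absurd rfl h, ?_⟩
    simp only [lt_irrefl, if_false, if_true]
    push_cast
    rw [div_one]
    ring
  · obtain ⟨h1, h2⟩ := integral_bIntegrand hb hb1 t
    refine ⟨_, h1.hasPVIntegral _, h1.re, fun _ => ⟨h1, rfl⟩, ?_⟩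
    rw [h2, if_neg hb1, ← mul_assoc, show 1 / (2 * (b : ℂ)) * (2 * b) = 1 by field_simp, one_mul]
    split_ifs <;> push_cast <;> ring

lemma exists_bIntegrand_formula (t : ℝ) {b : ℝ} (hb : b ≠ 0) :
    ∃ J : ℂ,
      HasPVIntegral (bIntegrand t b) (b * t) J ∧
      Integrable (fun v : ℝ => (bIntegrand t b v).re) ∧
      ∫ v : ℝ, (bIntegrand t b v).re = J.re ∧
      (|b| ≠ 1 → Integrable (bIntegrand t b) ∧ ∫ v : ℝ, bIntegrand t b v = J) ∧
      (poleWeight ((1 - b) / 2) b ≠ 0 → bDenominator t b ≠ 0) ∧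
      riemannZeta (1 / 2 + I * (t : ℂ)) =
        1 / (2 * ((|b| : ℝ) : ℂ)) * J -
          I * (Real.pi : ℂ) * (poleWeight ((1 - b) / 2) b : ℂ) /
            (bDenominator t b * (b : ℂ)) := by
  have hone (h : poleWeight ((1 - b) / 2) b ≠ 0) : 1 ≤ |b| := by
    rw [poleWeight_symm] at h
    split_ifs at h with h1 h2
    · exact h1.le
    · exact h2.ge
    · exact absurd rfl h
  rcases hb.lt_or_gt with hneg | hpos
  · obtain ⟨c, rfl⟩ : ∃ c, b = -c := ⟨-b, by ring⟩
    have hc : 0 < c := by linarith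
    obtain ⟨J, h1, h2, h3, h4⟩ := exists_bIntegrand_formula_of_pos t hc
    have hf : bIntegrand t (-c) = fun v => bIntegrand t c (-v) := funext (bIntegrand_neg t c)
    have hPV : HasPVIntegral (bIntegrand t (-c)) (-c * t) J := by
      rw [hf, neg_mul]
      exact h1.comp_neg
    have hr : Integrable fun v => (bIntegrand t (-c) v).re := by
      rw [hf]
      exact h2.comp_neg
    rw [abs_neg, abs_of_pos hc] at hone ⊢
    refine ⟨J, hPV, hr, hPV.integral_re hr, fun h => ?_, fun h h0 => ?_, ?_⟩
    · obtain ⟨h5, h6⟩ := h3 h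
      rw [hf, integral_neg_eq_self]
      exact ⟨h5.comp_neg, h6⟩
    · have := bDenominator_mul_neg t c
      rw [h0, zero_mul] at this
      exact mul_ne_zero (bDenominator_ne_zero (hone h) t) (ofReal_ne_zero.mpr hc.ne') this.symm
    · rw [bDenominator_mul_neg, poleWeight_symm, abs_neg, ← poleWeight_symm]
      exact h4
  · obtain ⟨J, h1, h2, h3, h4⟩ := exists_bIntegrand_formula_of_pos t hpos
    rw [abs_of_pos hpos] at hone ⊢
    exact ⟨J, h1, h2, h1.integral_re h2, h3, fun h => bDenominator_ne_zero (hone h) t, h4⟩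

lemma bIntegrand_one (t : ℝ) : bIntegrand t 1 = boundaryIntegrand t := by
  ext v
  rw [bIntegrand, boundaryIntegrand, div_one]
  push_cast
  norm_num

theorem mainTheorem9 :
    (∀ t : ℝ, 0 ≤ t →
      ∃ J : ℂ,
        HasPVIntegral (boundaryIntegrand t) t J ∧
        Integrable (fun v : ℝ => (boundaryIntegrand t v).re) ∧
        ∫ v : ℝ, (boundaryIntegrand t v).re = J.re ∧
        riemannZeta (1 / 2 + I * (t : ℂ)) =
          1 / 2 * J - (Real.pi : ℂ) / (2 * (Real.cosh (Real.pi * t) : ℂ))) ∧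
    (∀ t b : ℝ, b ≠ 0 →
      ∃ J : ℂ,
        HasPVIntegral (bIntegrand t b) (b * t) J ∧
        Integrable (fun v : ℝ => (bIntegrand t b v).re) ∧
        ∫ v : ℝ, (bIntegrand t b v).re = J.re ∧
        (|b| ≠ 1 → Integrable (bIntegrand t b) ∧ ∫ v : ℝ, bIntegrand t b v = J) ∧
        (poleWeight ((1 - b) / 2) b ≠ 0 → bDenominator t b ≠ 0) ∧
        riemannZeta (1 / 2 + I * (t : ℂ)) =
          1 / (2 * ((|b| : ℝ) : ℂ)) * J -
            I * (Real.pi : ℂ) * (poleWeight ((1 - b) / 2) b : ℂ) /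
              (bDenominator t b * (b : ℂ))) := by
  refine ⟨fun t _ => ?_, fun t b hb => exists_bIntegrand_formula t hb⟩
  obtain ⟨J, h1, h2, h3, -, -, h4⟩ := exists_bIntegrand_formula t one_ne_zero
  rw [bIntegrand_one, one_mul] at h1
  simp only [bIntegrand_one] at h2 h3
  refine ⟨J, h1, h2, h3, ?_⟩
  rw [h4, poleWeight_symm, abs_one, if_neg (lt_irrefl _), if_pos rfl, bDenominator, mul_one, div_one,
    Real.cos_pi_div_two, Real.sin_pi_div_two]
  have hc : (Real.cosh (Real.pi * t) : ℂ) ≠ 0 := ofReal_ne_zero.mpr (Real.cosh_pos _).ne'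
  push_cast at hc ⊢
  field_simp
  ring
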